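/- Let $\varphi=[\varphi_1,\dots,\varphi_r]$ be a multigerm of a reduced plane curve germ at the origin of $\mathbb C^2$ with $r$ branches: each $\varphi_i(t_i)=(x_i(t_i),y_i(t_i))=(a_it_i^{n_i}+\cdots,\,b_it_i^{n_i}+\cdots)$, with $n_i\ge 1$ and $(a_i,b_i)\ne(0,0)$, is a pair of convergent power series which is a primitive parametrization of a branch of multiplicity $n_i$ (that is, it does not factor through a germ $(\mathbb C,0)\to(\mathbb C,0)$ of order at least $2$), and the $r$ branches are pairwise distinct. Let $\theta(\varphi_i)=b_i/a_i\in\mathbb C\cup\{\infty\}$ be the slope of the tangent line of the $i$-th branch. Assume that $\varphi$ is in block form with $s$ blocks: the sequence $\varphi_1,\dots,\varphi_r$ is divided into $s$ consecutive nonempty blocks $B_1,\dots,B_s$ such that two branches have the same slope if and only if they lie in the same block, the slopes of $B_1,B_2,B_3$ (as far as these blocks exist) are $0,\infty,1$ respectively, the multiplicities do not decrease within each block, and the multiplicities of the first elements of $B_1,\dots,B_s$ do not decrease. Put $\varphi_i^*(h)=h(x_i,y_i)$, $\varphi^*(h)=(\varphi_1^*(h),\dots,\varphi_r^*(h))$ and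 $\nu_i(h)=\mathrm{ord}_{t_i}\,\varphi_i^*(h)\in\overline{\mathbb N}=\mathbb N\cup\{\infty\}$ for $h\in\mathbb C\{X,Y\}$. Let $\mathcal O=\varphi^*(\mathbb C\{X,Y\})\subseteq\overline{\mathcal O}=\bigoplus_{i=1}^r\mathbb C\{t_i\}$, let $(\mathcal O:\overline{\mathcal O})=\{p\in\mathcal O : p\,\overline{\mathcal O}\subseteq\mathcal O\}$ be the conductor ideal, $(\mathcal O:\overline{\mathcal O})^c$ its preimage under $\varphi^*$ in $\mathbb C\{X,Y\}$, $\mathcal M=\langle X,Y\rangle\subset\mathbb C\{X,Y\}$, and let $\Gamma=\{(\nu_1(h),\dots,\nu_r(h)) : h\in\mathbb C\{X,Y\}\}\subseteq\overline{\mathbb N}^r$ be the value semiring. A conductor of a set $\Delta\subseteq\overline{\mathbb N}^m$ is an element $c\in\mathbb N^m$ such that $c+\overline{\mathbb N}^m\subseteq\Delta$ and $c-e_i\notin\Delta$ for every vector $e_i$ of the canonical basis. Then $\Gamma$ has a unique conductor $\kappa=(\kappa_1,\dots,\kappa_r)$, and for each $i\in\{1,\dots,r\}$ the set $\nu_i\left(\mathcal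 M^2\cap(\mathcal O:\overline{\mathcal O})^c\right)\subseteq\overline{\mathbb N}$ has a unique conductor $d_i$, which is $$d_i=\begin{cases}\kappa_i+2 & \text{if } r=1 \text{ and } n_i\le 2;\\ \kappa_i+1 & \text{if } r=s=2 \text{ and } n_1=n_2=1;\\ \kappa_i & \text{otherwise.}\end{cases}$$ -/

import Mathlib

open Filter Topology

namespace PlaneCurve

noncomputable section

/-- The ring of germs at the origin of `ℂ`-analytic functions `E → ℂ`, i.e. the ring of
convergent power series: `ℂ{t}` for `E = ℂ` and `ℂ{X, Y}` for `E = ℂ × ℂ`. -/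
def analyticGerms (E : Type) [NormedAddCommGroup E] [NormedSpace ℂ E] :
    Subring (Germ (𝓝 (0 : E)) ℂ) where
  carrier := {g | ∃ f : E → ℂ, AnalyticAt ℂ f 0 ∧ (f : Germ (𝓝 (0 : E)) ℂ) = g}
  mul_mem' := by
    rintro _ _ ⟨f, hf, rfl⟩ ⟨g, hg, rfl⟩
    exact ⟨f * g, hf.mul hg, rfl⟩
  one_mem' := ⟨fun _ => 1, analyticAt_const, rfl⟩
  add_mem' := by
    rintro _ _ ⟨f, hf, rfl⟩ ⟨g, hg, rfl⟩
    exact ⟨f + g, hf.add hg, rfl⟩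
  zero_mem' := ⟨fun _ => 0, analyticAt_const, rfl⟩
  neg_mem' := by
    rintro _ ⟨f, hf, rfl⟩
    exact ⟨-f, hf.neg, rfl⟩

/-- `ℂ{t}`. -/
abbrev OneVar : Type := analyticGerms ℂ

/-- `ℂ{X, Y}`. -/
abbrev TwoVar : Type := analyticGerms (ℂ × ℂ)

/-- The coordinate `X` of `ℂ{X, Y}`. -/
def coordX : TwoVar := ⟨((fun p : ℂ × ℂ => p.1) : Germ (𝓝 (0 : ℂ × ℂ)) ℂ), _, analyticAt_fst, rfl⟩

/-- The coordinate `Y` of `ℂ{X, Y}`. -/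
def coordY : TwoVar := ⟨((fun p : ℂ × ℂ => p.2) : Germ (𝓝 (0 : ℂ × ℂ)) ℂ), _, analyticAt_snd, rfl⟩

/-- The maximal ideal `ℳ = ⟨X, Y⟩` of `ℂ{X, Y}`. -/
def maxIdeal : Ideal TwoVar := Ideal.span {coordX, coordY}

/-- The order `ord_t : ℂ{t} → ℕ ∪ {∞}`, with `ord_t 0 = ∞`. -/
def ord (g : OneVar) : ℕ∞ :=
  Germ.liftOn (g : Germ (𝓝 (0 : ℂ)) ℂ) (fun f => analyticOrderAt f 0)
    (fun _ _ h => analyticOrderAt_congr h)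

/-- An analytic map-germ `(ℂ, 0) → (ℂ², 0)`, `t ↦ (x(t), y(t))` (given by a representative). -/
structure MapGerm where
  toFun : ℂ → ℂ × ℂ
  analyticAt : AnalyticAt ℂ toFun 0
  map_zero : toFun 0 = 0

namespace MapGerm

variable (φ : MapGerm)

/-- The first component `x(t)`. -/
def x (t : ℂ) : ℂ := (φ.toFun t).1

/-- The second component `y(t)`. -/
def y (t : ℂ) : ℂ := (φ.toFun t).2

theorem tendsto : Tendsto φ.toFun (𝓝 0) (𝓝 0) := by
  have h := φ.analyticAt.continuousAt.tendsto
  rwa [φ.map_zero] at h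

/-- The homomorphism `φ^* : ℂ{X, Y} → ℂ{t}`, `h ↦ h(x(t), y(t))`. -/
def pullback : TwoVar →+* OneVar where
  toFun h := ⟨(h : Germ (𝓝 (0 : ℂ × ℂ)) ℂ).compTendsto φ.toFun φ.tendsto, by
    obtain ⟨_, f, hf, rfl⟩ := h
    refine ⟨f ∘ φ.toFun, ?_, rfl⟩
    refine AnalyticAt.comp ?_ φ.analyticAt
    rw [φ.map_zero]
    exact hf⟩
  map_one' := rfl
  map_zero' := rfl
  map_mul' := by
    rintro ⟨_, f, hf, rfl⟩ ⟨_, g, hg, rfl⟩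
    rfl
  map_add' := by
    rintro ⟨_, f, hf, rfl⟩ ⟨_, g, hg, rfl⟩
    rfl

/-- `φ` is primitive: it does not factor through a map-germ `ρ : (ℂ, 0) → (ℂ, 0)` of order at
least two (equivalently, no reparametrization of `φ` is a series in `t ^ k` with `k ≥ 2`).
In particular `φ` is not constant. -/
def IsPrimitive : Prop :=
  ¬ ∃ (ψ : MapGerm) (ρ : ℂ → ℂ), AnalyticAt ℂ ρ 0 ∧ ρ 0 = 0 ∧ 2 ≤ analyticOrderAt ρ 0 ∧
    φ.toFun =ᶠ[𝓝 0] ψ.toFun ∘ ρ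

/-- The multiplicity `n = min (ord x) (ord y)`, so that `φ = (a t ^ n + ⋯, b t ^ n + ⋯)` with
`a ≠ 0` or `b ≠ 0` (for `φ ≠ 0`). -/
def mult : ℕ := (min (analyticOrderAt φ.x 0) (analyticOrderAt φ.y 0)).toNat

/-- The coefficient `a` of `t ^ n` in `x(t)`, where `n` is the multiplicity. -/
def leadX : ℂ := iteratedDeriv φ.mult φ.x 0 / (φ.mult.factorial : ℂ)

/-- The coefficient `b` of `t ^ n` in `y(t)`, where `n` is the multiplicity. -/
def leadY : ℂ := iteratedDeriv φ.mult φ.y 0 / (φ.mult.factorial : ℂ)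

open Classical in
/-- The slope `b / a ∈ ℂ ∪ {∞}` of the tangent line `a Y - b X = 0`. -/
def slope : OnePoint ℂ :=
  if φ.leadX = 0 then OnePoint.infty else ((φ.leadY / φ.leadX : ℂ) : OnePoint ℂ)

end MapGerm

/-- A multigerm `[φ₁, …, φ_r]` of a reduced plane curve with `r` branches: primitive
parametrizations of pairwise distinct branches. The branch parametrized by `φᵢ` is the zero locus
of `fᵢ`, where `ker φᵢ^* = ⟨fᵢ⟩`; so two branches agree exactly when the kernels agree. -/
structure Multigerm (r : ℕ) where
  branch : Fin r → MapGerm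
  primitive : ∀ i, (branch i).IsPrimitive
  distinct : ∀ i j, i ≠ j →
    RingHom.ker (branch i).pullback ≠ RingHom.ker (branch j).pullback

namespace Multigerm

variable {r : ℕ} (φ : Multigerm r)

/-- The multiplicity `nᵢ` of the `i`-th branch. -/
def mult (i : Fin r) : ℕ := (φ.branch i).mult

/-- `φ` is in block form with exactly `s` blocks. The blocks are the fibres of `b`: being the
fibres of a monotone surjection, they are `s` consecutive non-empty intervals of indices. -/
def IsBlockForm (s : ℕ) : Prop :=
  ∃ (b : Fin r → Fin s) (θ : Fin s → OnePoint ℂ),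
    Monotone b ∧ Function.Surjective b ∧
    -- the branches of a block have the slope of the block, different blocks different slopes
    (∀ i, (φ.branch i).slope = θ (b i)) ∧ Function.Injective θ ∧
    -- the slopes of the first three blocks (those that exist) are `0`, `∞` and `1`
    (∀ l : Fin s, l.val = 0 → θ l = ((0 : ℂ) : OnePoint ℂ)) ∧
    (∀ l : Fin s, l.val = 1 → θ l = OnePoint.infty) ∧
    (∀ l : Fin s, l.val = 2 → θ l = ((1 : ℂ) : OnePoint ℂ)) ∧
    -- multiplicities do not decrease within a block
    (∀ j k, b j = b k → j < k → φ.mult j ≤ φ.mult k) ∧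
    -- multiplicities of the first branches of the blocks do not decrease
    (∀ j k, (∀ i, b i = b j → j ≤ i) → (∀ i, b i = b k → k ≤ i) → j ≤ k → φ.mult j ≤ φ.mult k)

/-- `φ^* : ℂ{X, Y} → ⨁ ℂ{tᵢ}`, `h ↦ (φ₁^*(h), …, φ_r^*(h))`. -/
def pullback : TwoVar →+* (Fin r → OneVar) := RingHom.pi fun i => (φ.branch i).pullback

/-- The local ring `𝒪`, as the subring `φ^*(ℂ{X, Y})` of its integral closure
`⨁ ℂ{tᵢ}`. -/
def localRing : Subring (Fin r → OneVar) := φ.pullback.range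

/-- The conductor ideal `(𝒪 : 𝒪̅) = {p ∈ 𝒪 | p 𝒪̅ ⊆ 𝒪}`, where `𝒪̅ = ⨁ ℂ{tᵢ}`. -/
def conductorIdeal : Set (Fin r → OneVar) :=
  {p | p ∈ φ.localRing ∧ ∀ z : Fin r → OneVar, p * z ∈ φ.localRing}

/-- The value `νᵢ(h) = ord (φᵢ^*(h))`. -/
def val (i : Fin r) (h : TwoVar) : ℕ∞ := ord ((φ.branch i).pullback h)

/-- The value semiring `Γ = {(ν₁(h), …, ν_r(h)) | h ∈ ℂ{X, Y}}`. -/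
def valueSemiring : Set (Fin r → ℕ∞) := {γ | ∃ h : TwoVar, ∀ i, γ i = φ.val i h}

/-- The set `νᵢ(ℳ² ∩ (𝒪 : 𝒪̅)ᶜ)`, where `(𝒪 : 𝒪̅)ᶜ` is the contraction of the conductor
ideal to `ℂ{X, Y}` by `φ^*`. -/
def determinacyValues (i : Fin r) : Set ℕ∞ :=
  {n | ∃ h : TwoVar, h ∈ maxIdeal ^ 2 ∧ φ.pullback h ∈ φ.conductorIdeal ∧ n = φ.val i h}

end Multigerm

/-- `c` is a conductor of `Δ ⊆ (ℕ ∪ {∞})^r`: `c + (ℕ ∪ {∞})^r ⊆ Δ` and `c - eᵢ ∉ Δ` for every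
vector `eᵢ` of the canonical basis (which holds trivially if `cᵢ = 0`). -/
def IsConductor {r : ℕ} (Δ : Set (Fin r → ℕ∞)) (c : Fin r → ℕ) : Prop :=
  (∀ γ : Fin r → ℕ∞, (∀ i, (c i : ℕ∞) ≤ γ i) → γ ∈ Δ) ∧
  ∀ (i : Fin r) (γ : Fin r → ℕ∞), γ i + 1 = (c i : ℕ∞) → (∀ j, j ≠ i → γ j = (c j : ℕ∞)) → γ ∉ Δ

/-- The same notion for `r = 1`: `d` is a conductor of `S ⊆ ℕ ∪ {∞}` if `d + (ℕ ∪ {∞}) ⊆ S` and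
`d - 1 ∉ S`. -/
def IsConductorOne (S : Set ℕ∞) (d : ℕ) : Prop :=
  (∀ n : ℕ∞, (d : ℕ∞) ≤ n → n ∈ S) ∧ ∀ n : ℕ∞, n + 1 = (d : ℕ∞) → n ∉ S

end

end PlaneCurve

/-!
The first task is to show that `𝒪` contains all tuples of large order. Choose `c` such that
`X + c Y` vanishes on no branch. In a suitable coordinate `sᵢ` of the `i`-th branch this linear form
is `sᵢ ^ mᵢ`, so `⨁ ℂ{tᵢ}` is free of rank `n = ∑ mᵢ` over the ring `A` of convergent series in
`X + c Y`, with basis the powers `sᵢ ^ j`, `j < mᵢ`. Substituting the `mᵢ`-th roots of unity turns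
the restrictions of `Y` into `n` conjugate series. They are pairwise distinct: two conjugates from
the same branch are distinct because the parametrization is primitive, and two from different
branches because the kernels of the pullbacks differ. By the Vandermonde determinant
`1, Y, …, Y ^ (n - 1)` are linearly independent over `A` (`Multigerm.eq_zero_of_sum_eq_zero`), so
the determinant of their coordinates in the basis is nonzero, and by Cramer's rule it multiplies
`⨁ ℂ{tᵢ}` into `𝒪` (`Multigerm.exists_forall_le_ord_mem_localRing`).

The exponent vectors `c` such that all tuples of order at least `c` lie in `𝒪` therefore have a
minimum `κ`, and minimality means that no element of `𝒪` has order `κᵢ - 1` in one place and at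
least `κⱼ` in the others (`Multigerm.IsConductorExponent`). Hence `κ` is the only conductor of the
value semiring, and the conductor ideal consists of the tuples of order at least `κ`. It remains to
decide which values `n ≥ κᵢ` are taken by germs in `ℳ ^ 2` that lie over the conductor.

* With at least two branches, take `h` with value `n` on the `i`-th branch that vanishes on the
  others. If `h ∉ ℳ ^ 2`, then `h` is part of a system of local coordinates, so that it vanishes on
  at most one branch, which is smooth, and every germ vanishing there is a multiple of `h` up to
  high order. As `n + 1` is a value of such a multiple, the `i`-th branch is smooth as well. This
  leaves two smooth branches, where powers of the coordinates settle the question: `κᵢ ≥ 2` if they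
  are tangent, and `κ = (1, 1)` if they are transversal.
* With one branch of multiplicity at least three, a germ `h ∉ ℳ ^ 2` with a value `v ≥ κ` that is
  not a multiple of the multiplicity `n` would confine the values below `2 v` to
  `n ℕ ∪ (v + n ℕ)`, which does not contain both `v + 1` and `v + 2`
  (`MapGerm.IsPrimitive.exists_mem_sq_ord_eq`). In multiplicity two the smallest odd value is
  `κ + 1`, and it is not a value on `ℳ ^ 2` (`MapGerm.ord_ne_of_mem_sq`); in multiplicity one
  `κ = 0`, whereas values on `ℳ ^ 2` are at least two.
-/
open scoped Matrix

namespace PlaneCurve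

noncomputable section

/-! ### The rings of germs -/

section Germs

variable {E : Type} [NormedAddCommGroup E] [NormedSpace ℂ E]

/-- The germ at the origin of a function that is analytic there. -/
def mkGerm (f : E → ℂ) (hf : AnalyticAt ℂ f 0) : analyticGerms E := 
  ⟨(f : Germ (𝓝 (0 : E)) ℂ), f, hf, rfl⟩

theorem exists_eq_mkGerm (g : analyticGerms E) : ∃ f hf, g = mkGerm f hf := by
  obtain ⟨_, f, hf, rfl⟩ := g
  exact ⟨f, hf, rfl⟩

theorem mkGerm_eq_iff {f g : E → ℂ} {hf : AnalyticAt ℂ f 0} {hg : AnalyticAt ℂ g 0} :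
    mkGerm f hf = mkGerm g hg ↔ f =ᶠ[𝓝 0] g := by
  exact Subtype.ext_iff.trans Germ.coe_eq

variable (E) in
/-- The constant germs. -/
def constGerm : ℂ →+* analyticGerms E where
  toFun c := mkGerm (fun _ => c) analyticAt_const
  map_one' := rfl
  map_zero' := rfl
  map_mul' _ _ := rfl
  map_add' _ _ := rfl

/-- The value of a germ at the origin. -/
def evalZero : analyticGerms E →+* ℂ := Germ.valueRingHom.comp (analyticGerms E).subtype

@[simp] theorem evalZero_mkGerm (f : E → ℂ) (hf : AnalyticAt ℂ f 0) :
    evalZero (mkGerm f hf) = f 0 := rfl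

@[simp] theorem evalZero_constGerm (c : ℂ) : evalZero (constGerm E c) = c := rfl

theorem isUnit_of_evalZero_ne_zero {g : analyticGerms E} (h : evalZero g ≠ 0) : IsUnit g := by
  obtain ⟨f, hf, rfl⟩ := exists_eq_mkGerm g
  rw [evalZero_mkGerm] at h
  refine IsUnit.of_mul_eq_one (mkGerm (fun z => (f z)⁻¹) (hf.inv h)) ?_
  change mkGerm (fun z => f z * (f z)⁻¹) (hf.mul (hf.inv h)) = mkGerm (fun _ => 1) analyticAt_const
  rw [mkGerm_eq_iff]
  filter_upwards [hf.continuousAt.eventually_ne h] with z hz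
  exact mul_inv_cancel₀ hz

theorem isUnit_iff_evalZero_ne_zero {g : analyticGerms E} : IsUnit g ↔ evalZero g ≠ 0 :=
  ⟨fun h => (h.map evalZero).ne_zero, isUnit_of_evalZero_ne_zero⟩

instance : Nontrivial (analyticGerms E) := (evalZero (E := E)).domain_nontrivial

end Germs

theorem ord_mkGerm (f : ℂ → ℂ) (hf : AnalyticAt ℂ f 0) :
    ord (mkGerm f hf) = analyticOrderAt f 0 := rfl

@[simp] theorem ord_eq_top {g : OneVar} : ord g = ⊤ ↔ g = 0 := by
  obtain ⟨f, hf, rfl⟩ := exists_eq_mkGerm g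
  rw [ord_mkGerm, analyticOrderAt_eq_top]
  exact (mkGerm_eq_iff (hf := hf) (hg := analyticAt_const (v := (0 : ℂ)))).symm

@[simp] theorem ord_zero : ord 0 = ⊤ := ord_eq_top.2 rfl

theorem ord_mul (g h : OneVar) : ord (g * h) = ord g + ord h := by
  obtain ⟨f, hf, rfl⟩ := exists_eq_mkGerm g
  obtain ⟨k, hk, rfl⟩ := exists_eq_mkGerm h
  exact analyticOrderAt_mul hf hk

instance : NoZeroDivisors OneVar where
  eq_zero_or_eq_zero_of_mul_eq_zero {a b} h := by
    rw [← ord_eq_top, ord_mul] at h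
    rw [← ord_eq_top, ← ord_eq_top]
    exact WithTop.add_eq_top.1 h

instance : IsDomain OneVar := NoZeroDivisors.to_isDomain _

theorem ord_eq_zero {g : OneVar} : ord g = 0 ↔ evalZero g ≠ 0 := by
  obtain ⟨f, hf, rfl⟩ := exists_eq_mkGerm g
  exact hf.analyticOrderAt_eq_zero

theorem ord_of_isUnit {g : OneVar} (h : IsUnit g) : ord g = 0 :=
  ord_eq_zero.2 (isUnit_iff_evalZero_ne_zero.1 h)

@[simp] theorem ord_one : ord 1 = 0 := ord_of_isUnit isUnit_one

theorem ord_pow (g : OneVar) (n : ℕ) : ord (g ^ n) = n * ord g := by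
  induction n with
  | zero => simp
  | succ n ih => rw [pow_succ, ord_mul, ih]; push_cast; ring

theorem one_le_ord {g : OneVar} : 1 ≤ ord g ↔ evalZero g = 0 := by
  rw [Order.one_le_iff_ne_zero, Ne, ord_eq_zero, not_not]

theorem le_ord_add {n : ℕ∞} {g h : OneVar} (hg : n ≤ ord g) (hh : n ≤ ord h) : n ≤ ord (g + h) := by
  obtain ⟨f, hf, rfl⟩ := exists_eq_mkGerm g
  obtain ⟨k, hk, rfl⟩ := exists_eq_mkGerm h
  exact (le_min hg hh).trans le_analyticOrderAt_add

@[simp] theorem ord_neg (g : OneVar) : ord (-g) = ord g := by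
  obtain ⟨f, hf, rfl⟩ := exists_eq_mkGerm g
  exact analyticOrderAt_neg

theorem le_ord_sub {n : ℕ∞} {g h : OneVar} (hg : n ≤ ord g) (hh : n ≤ ord h) : n ≤ ord (g - h) := by
  rw [sub_eq_add_neg]
  exact le_ord_add hg (by rwa [ord_neg])

theorem ord_add_eq_left {g h : OneVar} (hlt : ord g < ord h) : ord (g + h) = ord g := by
  obtain ⟨f, hf, rfl⟩ := exists_eq_mkGerm g
  obtain ⟨k, hk, rfl⟩ := exists_eq_mkGerm h
  exact analyticOrderAt_add_eq_left_of_lt hlt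

theorem ord_add_eq_right {g h : OneVar} (hlt : ord h < ord g) : ord (g + h) = ord h := by
  rw [add_comm, ord_add_eq_left hlt]

theorem le_ord_mul_right {n : ℕ∞} {g : OneVar} (h : OneVar) (hg : n ≤ ord g) : n ≤ ord (g * h) := by
  rw [ord_mul]; exact hg.trans le_self_add

theorem le_ord_mul_left {n : ℕ∞} {g : OneVar} (h : OneVar) (hg : n ≤ ord g) : n ≤ ord (h * g) := by
  rw [mul_comm]; exact le_ord_mul_right h hg

/-- The coordinate `t` of `ℂ{t}`. -/
def tVar : OneVar := mkGerm (fun z => z) analyticAt_id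

@[simp] theorem ord_tVar : ord tVar = 1 := analyticOrderAt_id

@[simp] theorem ord_tVar_pow (n : ℕ) : ord (tVar ^ n) = n := by simp [ord_pow]

theorem exists_eq_tVar_pow_mul {n : ℕ} {g : OneVar} (h : (n : ℕ∞) ≤ ord g) :
    ∃ u, g = tVar ^ n * u := by
  obtain ⟨f, hf, rfl⟩ := exists_eq_mkGerm g
  rw [ord_mkGerm, natCast_le_analyticOrderAt hf] at h
  obtain ⟨k, hk, h⟩ := h
  refine ⟨mkGerm k hk, ?_⟩
  change _ = mkGerm (fun z => z ^ n * k z) ((analyticAt_id.pow n).mul hk)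
  rw [mkGerm_eq_iff]
  filter_upwards [h] with z hz
  simpa using hz

theorem exists_eq_tVar_pow_mul_unit {n : ℕ} {g : OneVar} (h : ord g = n) :
    ∃ u, IsUnit u ∧ g = tVar ^ n * u := by
  obtain ⟨u, rfl⟩ := exists_eq_tVar_pow_mul h.ge
  refine ⟨u, ?_, rfl⟩
  rw [ord_mul, ord_tVar_pow] at h
  rw [isUnit_iff_evalZero_ne_zero, ← ord_eq_zero]
  simpa using h

/-- Divisibility in the discrete valuation ring `ℂ{t}` is read off the orders. -/
theorem dvd_of_ord_le {g h : OneVar} (hle : ord g ≤ ord h) : g ∣ h := by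
  by_cases h0 : ord g = ⊤
  · rw [h0, top_le_iff, ord_eq_top] at hle
    simp [hle]
  · lift ord g to ℕ using h0 with n hn
    obtain ⟨u, hu, rfl⟩ := exists_eq_tVar_pow_mul_unit hn.symm
    obtain ⟨v, rfl⟩ := exists_eq_tVar_pow_mul hle
    exact mul_dvd_mul_left _ hu.dvd

/-- Two series of order at least `n`, one of them of order exactly `n`, have a linear combination
of order greater than `n`. -/
theorem exists_lt_ord_sub {n : ℕ} {p q : OneVar} (hp : ord p = n) (hq : (n : ℕ∞) ≤ ord q) :
    ∃ c : ℂ, ((n + 1 : ℕ) : ℕ∞) ≤ ord (q - constGerm ℂ c * p) := by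
  obtain ⟨u, hu, rfl⟩ := exists_eq_tVar_pow_mul_unit hp
  obtain ⟨v, rfl⟩ := exists_eq_tVar_pow_mul hq
  rw [isUnit_iff_evalZero_ne_zero] at hu
  refine ⟨evalZero v / evalZero u, ?_⟩
  have : tVar ^ n * v - constGerm ℂ (evalZero v / evalZero u) * (tVar ^ n * u) =
      tVar ^ n * (v - constGerm ℂ (evalZero v / evalZero u) * u) := by ring
  rw [this, ord_mul, ord_tVar_pow, Nat.cast_add, Nat.cast_one]
  gcongr
  rw [one_le_ord, map_sub, map_mul, evalZero_constGerm]
  field_simp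
  ring

theorem germ_tendsto_of_evalZero {u : OneVar} (hu : evalZero u = 0) :
    (u : Germ (𝓝 (0 : ℂ)) ℂ).Tendsto (𝓝 0) := by
  obtain ⟨ρ, hρ, rfl⟩ := exists_eq_mkGerm u
  rw [evalZero_mkGerm] at hu
  have := hρ.continuousAt.tendsto
  rwa [hu] at this

theorem comp_analyticAt {f ρ : ℂ → ℂ} (hf : AnalyticAt ℂ f 0) (hρ : AnalyticAt ℂ ρ 0)
    (h0 : ρ 0 = 0) : AnalyticAt ℂ (f ∘ ρ) 0 := AnalyticAt.comp (by rwa [h0]) hρ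

/-- The substitution homomorphism `ℂ{t} → ℂ{t}`, `g ↦ g(u(t))`, for a series `u` without constant
term. -/
def subst (u : OneVar) (hu : evalZero u = 0) : OneVar →+* OneVar where
  toFun h := ⟨(h : Germ (𝓝 (0 : ℂ)) ℂ).compTendsto' (u : Germ (𝓝 (0 : ℂ)) ℂ)
      (germ_tendsto_of_evalZero hu), by
    obtain ⟨f, hf, rfl⟩ := exists_eq_mkGerm h
    obtain ⟨ρ, hρ, rfl⟩ := exists_eq_mkGerm u
    exact ⟨f ∘ ρ, comp_analyticAt hf hρ hu, rfl⟩⟩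
  map_one' := by
    obtain ⟨ρ, hρ, rfl⟩ := exists_eq_mkGerm u
    rfl
  map_zero' := by
    obtain ⟨ρ, hρ, rfl⟩ := exists_eq_mkGerm u
    rfl
  map_mul' g h := by
    obtain ⟨ρ, hρ, rfl⟩ := exists_eq_mkGerm u
    obtain ⟨f, hf, rfl⟩ := exists_eq_mkGerm g
    obtain ⟨k, hk, rfl⟩ := exists_eq_mkGerm h
    rfl
  map_add' g h := by
    obtain ⟨ρ, hρ, rfl⟩ := exists_eq_mkGerm u
    obtain ⟨f, hf, rfl⟩ := exists_eq_mkGerm g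
    obtain ⟨k, hk, rfl⟩ := exists_eq_mkGerm h
    rfl

theorem subst_mkGerm {ρ f : ℂ → ℂ} (hρ : AnalyticAt ℂ ρ 0) (hf : AnalyticAt ℂ f 0)
    (h0 : evalZero (mkGerm ρ hρ) = 0) :
    subst (mkGerm ρ hρ) h0 (mkGerm f hf) = mkGerm (f ∘ ρ) (comp_analyticAt hf hρ h0) := rfl

theorem ord_subst (u : OneVar) (hu : evalZero u = 0) (g : OneVar) :
    ord (subst u hu g) = ord g * ord u := by
  obtain ⟨f, hf, rfl⟩ := exists_eq_mkGerm g
  obtain ⟨ρ, hρ, rfl⟩ := exists_eq_mkGerm u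
  have h0 : ρ 0 = 0 := hu
  rw [subst_mkGerm, ord_mkGerm, ord_mkGerm, AnalyticAt.analyticOrderAt_comp (by rwa [h0]) hρ]
  simp [h0, ord_mkGerm]

theorem subst_injective (u : OneVar) (hu : evalZero u = 0) (hne : u ≠ 0) :
    Function.Injective (subst u hu) := by
  rw [injective_iff_map_eq_zero]
  intro g hg
  rw [← ord_eq_top, ord_subst] at hg
  rw [← ord_eq_top]
  by_contra h
  exact WithTop.mul_ne_top h (ord_eq_top.not.2 hne) hg

@[simp] theorem subst_constGerm (u : OneVar) (hu : evalZero u = 0) (c : ℂ) :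
    subst u hu (constGerm ℂ c) = constGerm ℂ c := by
  obtain ⟨ρ, hρ, rfl⟩ := exists_eq_mkGerm u
  rfl

@[simp] theorem subst_tVar (u : OneVar) (hu : evalZero u = 0) : subst u hu tVar = u := by
  obtain ⟨ρ, hρ, rfl⟩ := exists_eq_mkGerm u
  rfl

@[simp] theorem evalZero_subst (u : OneVar) (hu : evalZero u = 0) (g : OneVar) :
    evalZero (subst u hu g) = evalZero g := by
  obtain ⟨ρ, hρ, rfl⟩ := exists_eq_mkGerm u
  obtain ⟨f, hf, rfl⟩ := exists_eq_mkGerm g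
  have h0 : ρ 0 = 0 := hu
  rw [subst_mkGerm]
  simp [h0]

theorem subst_subst (u v : OneVar) (hu : evalZero u = 0) (hv : evalZero v = 0) (g : OneVar) :
    subst u hu (subst v hv g) = subst (subst u hu v) (by rwa [evalZero_subst]) g := by
  obtain ⟨ρ, hρ, rfl⟩ := exists_eq_mkGerm u
  obtain ⟨σ, hσ, rfl⟩ := exists_eq_mkGerm v
  obtain ⟨f, hf, rfl⟩ := exists_eq_mkGerm g
  rfl

@[simp] theorem evalZero_tVar : evalZero tVar = 0 := rfl

@[simp] theorem subst_tVar_left (g : OneVar) : subst tVar evalZero_tVar g = g := by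
  obtain ⟨f, hf, rfl⟩ := exists_eq_mkGerm g
  rfl

theorem subst_congr {u v : OneVar} (h : u = v) (hu : evalZero u = 0) (g : OneVar) :
    subst u hu g = subst v (h ▸ hu) g := by
  subst h; rfl

theorem evalZero_pow_eq_zero {u : OneVar} (hu : evalZero u = 0) {n : ℕ} (hn : n ≠ 0) :
    evalZero (u ^ n) = 0 := by
  rw [map_pow, hu, zero_pow hn]

/-! ### The conductor of a ring of tuples of power series -/

/-- A minimal exponent vector `κ` such that `O` contains all tuples of order at least `κ`: no
element of `O` has order `κᵢ - 1` in one place and at least `κⱼ` in the others, since with such an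
element the `i`-th exponent could be lowered. -/
theorem exists_conductor_exponents {ι : Type} [Fintype ι] [DecidableEq ι]
    {O : Subring (ι → OneVar)} (hC : ∀ c : ℂ, (fun _ => constGerm ℂ c) ∈ O) {N : ℕ}
    (hN : ∀ p : ι → OneVar, (∀ i, (N : ℕ∞) ≤ ord (p i)) → p ∈ O) :
    ∃ κ : ι → ℕ, (∀ p : ι → OneVar, (∀ i, (κ i : ℕ∞) ≤ ord (p i)) → p ∈ O) ∧
      ∀ i, ∀ p ∈ O, ord (p i) + 1 = κ i → ¬ ∀ j, j ≠ i → (κ j : ℕ∞) ≤ ord (p j) := by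
  let K : Set (ι → ℕ) := {c | ∀ p : ι → OneVar, (∀ i, (c i : ℕ∞) ≤ ord (p i)) → p ∈ O}
  have hK : (fun _ => N) ∈ K := hN
  obtain ⟨κ, hκ, hmin⟩ := exists_minimalFor_of_wellFoundedLT (· ∈ K) (fun c => ∑ i, c i) ⟨_, hK⟩
  refine ⟨κ, hκ, fun i p hp hpi hpj => ?_⟩
  have hκi : κ i ≠ 0 := by
    intro h0
    rw [h0] at hpi
    simp at hpi
  obtain ⟨k, hk⟩ := Nat.exists_eq_succ_of_ne_zero hκi
  have hpk : ord (p i) = k := by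
    rw [hk, Nat.succ_eq_add_one, Nat.cast_add, Nat.cast_one] at hpi
    exact (ENat.add_left_injective_of_ne_top (n := 1) (by simp)) hpi
  -- lowering the `i`-th exponent by one gives another element of `K`, with a smaller sum
  have hmem : Function.update κ i k ∈ K := by
    intro q hq
    have hqi : (k : ℕ∞) ≤ ord (q i) := by simpa using hq i
    obtain ⟨c, hc⟩ := exists_lt_ord_sub hpk hqi
    have hsub : q - (fun _ => constGerm ℂ c) * p ∈ O := by
      refine hκ _ fun j => ?_
      by_cases hj : j = i
      · subst hj
        rw [hk]
        exact hc
      · have := hq j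
        rw [Function.update_of_ne hj] at this
        exact le_ord_sub this (le_ord_mul_left _ (hpj j hj))
    have := O.add_mem hsub (O.mul_mem (hC c) hp)
    rwa [sub_add_cancel] at this
  have hlt : ∑ j, Function.update κ i k j < ∑ j, κ j := by
    refine Finset.sum_lt_sum (fun j _ => ?_) ⟨i, Finset.mem_univ _, ?_⟩
    · by_cases hj : j = i
      · subst hj; simp [hk]
      · simp [hj]
    · simp [hk]
  exact absurd (hmin hmem hlt.le) (not_le.2 hlt)

theorem exists_ord_eq (n : ℕ∞) : ∃ g : OneVar, ord g = n := by
  induction n using ENat.recTopCoe with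
  | top => exact ⟨0, ord_zero⟩
  | coe n => exact ⟨tVar ^ n, ord_tVar_pow n⟩

namespace Multigerm

variable {r : ℕ} (φ : Multigerm r)

theorem const_mem_localRing (c : ℂ) : (fun _ => constGerm ℂ c) ∈ φ.localRing :=
  ⟨constGerm _ c, rfl⟩

/-- `κ` is the exponent vector of the conductor: tuples of order at least `κ` lie in `𝒪`, and no
element of `𝒪` has order `κᵢ - 1` in the `i`-th place and at least `κⱼ` in the others. -/
structure IsConductorExponent (κ : Fin r → ℕ) : Prop where
  mem : ∀ p : Fin r → OneVar, (∀ i, (κ i : ℕ∞) ≤ ord (p i)) → p ∈ φ.localRing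
  minimal : ∀ (i : Fin r) (h : TwoVar), φ.val i h + 1 = κ i →
    ¬ ∀ j, j ≠ i → (κ j : ℕ∞) ≤ φ.val j h

theorem exists_isConductorExponent {N : ℕ}
    (hN : ∀ p : Fin r → OneVar, (∀ i, (N : ℕ∞) ≤ ord (p i)) → p ∈ φ.localRing) :
    ∃ κ, φ.IsConductorExponent κ := by
  obtain ⟨κ, h1, h2⟩ := exists_conductor_exponents φ.const_mem_localRing hN
  exact ⟨κ, h1, fun i h => h2 i (φ.pullback h) ⟨h, rfl⟩⟩

variable {φ} {κ : Fin r → ℕ}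

namespace IsConductorExponent

theorem exists_val_eq (hκ : φ.IsConductorExponent κ) (γ : Fin r → ℕ∞) (hγ : ∀ i, (κ i : ℕ∞) ≤ γ i) :
    ∃ h : TwoVar, ∀ i, φ.val i h = γ i := by
  choose g hg using exists_ord_eq
  obtain ⟨h, hh⟩ := hκ.mem (fun i => g (γ i)) (fun i => by rw [hg]; exact hγ i)
  refine ⟨h, fun i => ?_⟩
  rw [← hg (γ i)]
  exact congrArg ord (congrFun hh i)

theorem isConductor_iff (hκ : φ.IsConductorExponent κ) (c : Fin r → ℕ) :
    IsConductor φ.valueSemiring c ↔ c = κ := by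
  have hκc : IsConductor φ.valueSemiring κ := by
    refine ⟨fun γ hγ => ?_, ?_⟩
    · obtain ⟨h, hh⟩ := hκ.exists_val_eq γ hγ
      exact ⟨h, fun i => (hh i).symm⟩
    · rintro i γ hi hj ⟨h, hh⟩
      exact hκ.minimal i h (by rw [← hh, hi]) fun j hji => by rw [← hh, hj j hji]
  refine ⟨fun hc => ?_, fun h => h ▸ hκc⟩
  have hle : ∀ i, κ i ≤ c i := by
    intro i
    by_contra! hlt
    obtain ⟨k, hk⟩ := Nat.exists_eq_succ_of_ne_zero (Nat.ne_zero_of_lt hlt)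
    obtain ⟨h, hh⟩ := hc.1 (Function.update (fun _ => ⊤) i (k : ℕ∞)) (fun j => by
      by_cases hj : j = i
      · subst hj
        rw [Function.update_self]
        exact_mod_cast (by omega : c j ≤ k)
      · simp [hj])
    refine hκ.minimal i h ?_ fun j hj => ?_
    · rw [← hh i, hk]; simp
    · rw [← hh j]; simp [hj]
  funext i
  by_contra hne
  have hlt : κ i < c i := lt_of_le_of_ne (hle i) (Ne.symm hne)
  obtain ⟨k, hk⟩ := Nat.exists_eq_succ_of_ne_zero (Nat.ne_zero_of_lt hlt)
  refine hc.2 i (Function.update (fun j => (c j : ℕ∞)) i (k : ℕ∞)) (by simp [hk])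
    (fun j hj => by simp [hj]) (hκc.1 _ fun j => ?_)
  by_cases hj : j = i
  · subst hj
    rw [Function.update_self]
    exact_mod_cast (by omega : κ j ≤ k)
  · simp [hj, hle j]

/-- The conductor ideal consists of the tuples of order at least `κ`. -/
theorem mem_conductorIdeal_iff (hκ : φ.IsConductorExponent κ) (p : Fin r → OneVar) :
    p ∈ φ.conductorIdeal ↔ ∀ i, (κ i : ℕ∞) ≤ ord (p i) := by
  constructor
  · rintro ⟨-, hp⟩ i
    by_contra! hlt
    have hne : ord (p i) ≠ ⊤ := (hlt.trans_le le_top).ne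
    obtain ⟨a, ha⟩ := ENat.ne_top_iff_exists.1 hne
    rw [← ha] at hlt
    have hlt' : a < κ i := by exact_mod_cast hlt
    -- multiplying by a power of `tᵢ` produces an element of order exactly `κᵢ - 1`
    obtain ⟨h, hh⟩ := hp (Function.update 0 i (tVar ^ (κ i - 1 - a)))
    refine hκ.minimal i h ?_ fun j hj => ?_
    · change ord (φ.pullback h i) + 1 = _
      rw [hh, Pi.mul_apply, Function.update_self, ord_mul, ← ha, ord_tVar_pow]
      exact_mod_cast (by omega : a + (κ i - 1 - a) + 1 = κ i)
    · change _ ≤ ord (φ.pullback h j)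
      rw [hh, Pi.mul_apply, Function.update_of_ne hj]
      simp
  · exact fun h => ⟨hκ.mem p h, fun z => hκ.mem _ fun i => le_ord_mul_right _ (h i)⟩

theorem mem_determinacyValues_iff (hκ : φ.IsConductorExponent κ) (i : Fin r) (n : ℕ∞) :
    n ∈ φ.determinacyValues i ↔
    ∃ h ∈ maxIdeal ^ 2, (∀ j, (κ j : ℕ∞) ≤ φ.val j h) ∧ φ.val i h = n := by
  constructor
  · rintro ⟨h, h2, hc, rfl⟩
    exact ⟨h, h2, (hκ.mem_conductorIdeal_iff _).1 hc, rfl⟩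
  · rintro ⟨h, h2, hc, rfl⟩
    exact ⟨h, h2, (hκ.mem_conductorIdeal_iff _).2 hc, rfl⟩

end IsConductorExponent

end Multigerm

theorem isConductorOne_iff_of_isConductorOne {S : Set ℕ∞} {d : ℕ} (hd : IsConductorOne S d)
    (e : ℕ) : IsConductorOne S e ↔ e = d := by
  refine ⟨fun he => ?_, fun h => h ▸ hd⟩
  by_contra hne
  rcases lt_or_gt_of_ne hne with h | h
  · obtain ⟨k, hk⟩ := Nat.exists_eq_succ_of_ne_zero (Nat.ne_zero_of_lt h)
    exact hd.2 k (by simp [hk]) (he.1 k (by exact_mod_cast (by omega : e ≤ k)))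
  · obtain ⟨k, hk⟩ := Nat.exists_eq_succ_of_ne_zero (Nat.ne_zero_of_lt h)
    exact he.2 k (by simp [hk]) (hd.1 k (by exact_mod_cast (by omega : d ≤ k)))

/-! ### Local coordinates and expansions in one variable -/

theorem mkGerm_sum {E : Type} [NormedAddCommGroup E] [NormedSpace ℂ E] {ι : Type} (S : Finset ι)
    (f : ι → E → ℂ) (hf : ∀ i, AnalyticAt ℂ (f i) 0) :
    ∑ i ∈ S, mkGerm (f i) (hf i) = mkGerm (fun z => ∑ i ∈ S, f i z)
      (Finset.analyticAt_fun_sum S fun i _ => hf i) := by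
  classical
  induction S using Finset.induction_on with
  | empty => rfl
  | insert a S ha ih =>
    rw [Finset.sum_insert ha, ih]
    refine (mkGerm_eq_iff (hf := (hf a).add (Finset.analyticAt_fun_sum S fun i _ => hf i))).2 ?_
    exact .of_forall fun z => (Finset.sum_insert (f := fun i => f i z) ha).symm

theorem exists_pow_eq_of_isUnit {v : OneVar} (hv : IsUnit v) {m : ℕ} (hm : m ≠ 0) :
    ∃ r : OneVar, r ^ m = v := by
  obtain ⟨f, hf, rfl⟩ := exists_eq_mkGerm v
  rw [isUnit_iff_evalZero_ne_zero, evalZero_mkGerm] at hv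
  obtain ⟨a, ha⟩ := IsAlgClosed.exists_pow_nat_eq (f 0) (Nat.pos_of_ne_zero hm)
  have hg : AnalyticAt ℂ (fun z => a * Complex.exp (Complex.log (f z / f 0) / m)) 0 := by
    have h1 : AnalyticAt ℂ (fun z => Complex.log (f z / f 0)) 0 := by
      refine AnalyticAt.clog (hf.div_const) ?_
      rw [div_self hv]
      simp
    exact analyticAt_const.mul (AnalyticAt.cexp (h1.div_const))
  refine ⟨mkGerm _ hg, ?_⟩
  refine (mkGerm_eq_iff (hf := hg.pow m)).2 ?_
  filter_upwards [hf.continuousAt.eventually_ne hv] with z hz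
  have hmC : (m : ℂ) ≠ 0 := by exact_mod_cast hm
  change (a * Complex.exp (Complex.log (f z / f 0) / m)) ^ m = f z
  rw [mul_pow, ← Complex.exp_nat_mul, mul_div_cancel₀ _ hmC,
    Complex.exp_log (div_ne_zero hz hv), ha]
  field_simp

/-- A series of finite positive order is a power of a local coordinate. -/
theorem exists_pow_eq_of_ord_eq {u : OneVar} {m : ℕ} (hm : m ≠ 0) (hu : ord u = m) :
    ∃ s : OneVar, ord s = 1 ∧ s ^ m = u := by
  obtain ⟨v, hv, rfl⟩ := exists_eq_tVar_pow_mul_unit hu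
  obtain ⟨r, rfl⟩ := exists_pow_eq_of_isUnit hv hm
  refine ⟨tVar * r, ?_, mul_pow _ _ _⟩
  rw [ord_mul, ord_tVar, ord_of_isUnit ((isUnit_pow_iff hm).1 hv), add_zero]

/-- Local coordinates are invertible for composition. -/
theorem exists_subst_inverse {s : OneVar} (hs : ord s = 1) :
    ∃ (hs0 : evalZero s = 0) (T : OneVar) (hT0 : evalZero T = 0),
      subst s hs0 T = tVar ∧ subst T hT0 s = tVar := by
  have hs0 : evalZero s = 0 := one_le_ord.1 hs.ge
  refine ⟨hs0, ?_⟩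
  obtain ⟨f, hf, rfl⟩ := exists_eq_mkGerm s
  have h0 : f 0 = 0 := hs0
  have hd : deriv f 0 ≠ 0 := by
    intro hd
    have h2 : ((2 : ℕ) : ℕ∞) ≤ analyticOrderAt f 0 := by
      rw [natCast_le_analyticOrderAt_iff_iteratedDeriv_eq_zero hf]
      intro i hi
      interval_cases i
      · simpa using h0
      · simpa using hd
    rw [← ord_mkGerm f hf, hs] at h2
    exact absurd h2 (by decide)
  have hT := hf.analyticAt_localInverse hd
  have hT0 : hf.hasStrictDerivAt.localInverse _ _ _ hd 0 = 0 := by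
    have := HasStrictFDerivAt.localInverse_apply_image
      (hf.hasStrictDerivAt.hasStrictFDerivAt_equiv hd)
    rw [h0] at this
    exact this
  rw [h0] at hT
  refine ⟨mkGerm _ hT, hT0, ?_, ?_⟩
  · rw [subst_mkGerm]
    refine mkGerm_eq_iff.2 ?_
    exact HasStrictFDerivAt.eventually_left_inverse (hf.hasStrictDerivAt.hasStrictFDerivAt_equiv hd)
  · have := HasStrictFDerivAt.eventually_right_inverse
      (hf.hasStrictDerivAt.hasStrictFDerivAt_equiv hd)
    rw [h0] at this
    exact (mkGerm_eq_iff (hf := comp_analyticAt hf hT hT0) (hg := analyticAt_id)).2 this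

/-- Collecting the terms of a power series by the residue of the exponent modulo `m`. -/
theorem exists_residue_expansion {m : ℕ} (hm : m ≠ 0) (g : OneVar) :
    ∃ G : Fin m → OneVar, g = ∑ j, subst (tVar ^ m) (evalZero_pow_eq_zero evalZero_tVar hm) (G j) *
      tVar ^ (j : ℕ) := by
  obtain ⟨m, rfl⟩ := Nat.exists_eq_succ_of_ne_zero hm
  obtain ⟨f, hf, rfl⟩ := exists_eq_mkGerm g
  obtain ⟨p, R, hp⟩ := hf
  obtain ⟨ρ, hρ0, hρR⟩ := ENNReal.lt_iff_exists_nnreal_btwn.1 hp.r_pos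
  have hρ0 : 0 < ρ := by exact_mod_cast hρ0
  obtain ⟨C, hC, hbound⟩ := p.norm_mul_pow_le_of_lt_radius (hρR.trans_le hp.r_le)
  let q : Fin (m + 1) → FormalMultilinearSeries ℂ ℂ ℂ := fun j =>
    FormalMultilinearSeries.ofScalars ℂ fun k => p.coeff (j + (m + 1) * k)
  have hq : ∀ j, 0 < (q j).radius := by
    intro j
    refine lt_of_lt_of_le ?_
      ((q j).le_radius_of_bound (C / ρ ^ (j : ℕ)) (r := ρ ^ (m + 1)) fun k => ?_)
    · exact_mod_cast pow_pos hρ0 _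
    · have := hbound (j + (m + 1) * k)
      rw [FormalMultilinearSeries.ofScalars_norm, ← p.norm_apply_eq_norm_coef,
        le_div_iff₀ (by positivity)]
      refine le_of_eq_of_le ?_ this
      push_cast
      ring
  have hqan : ∀ j, AnalyticAt ℂ (q j).sum 0 := fun j =>
    ((q j).hasFPowerSeriesOnBall (hq j)).analyticAt
  refine ⟨fun j => mkGerm _ (hqan j), ?_⟩
  have key : ∀ j : Fin (m + 1), subst (tVar ^ (m + 1)) (evalZero_pow_eq_zero evalZero_tVar hm)
      (mkGerm _ (hqan j)) * tVar ^ (j : ℕ) = mkGerm (fun z => (q j).sum (z ^ (m + 1)) * z ^ (j : ℕ))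
      (((comp_analyticAt (hqan j) (analyticAt_id.pow (m + 1)) (by simp))).mul
        (analyticAt_id.pow _)) :=
    fun j => rfl
  simp only [key]
  rw [mkGerm_sum _ (fun (j : Fin (m + 1)) z => (q j).sum (z ^ (m + 1)) * z ^ (j : ℕ))]
  refine mkGerm_eq_iff.2 ?_
  have hball : Metric.eball (0 : ℂ) R ∈ 𝓝 0 := Metric.eball_mem_nhds _ hp.r_pos
  filter_upwards [hball] with z hz
  have hs := hp.hasSum hz
  rw [zero_add] at hs
  simp only [FormalMultilinearSeries.apply_eq_pow_smul_coeff, smul_eq_mul] at hs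
  rw [← hs.tsum_eq, Nat.sumByResidueClasses hs.summable (m + 1)]
  refine Finset.sum_congr rfl fun (j : Fin (m + 1)) _ => ?_
  have : (q j).sum (z ^ (m + 1)) = ∑' k, p.coeff (j + (m + 1) * k) * (z ^ (m + 1)) ^ k := by
    simp only [FormalMultilinearSeries.sum, q, FormalMultilinearSeries.ofScalars_apply_eq,
      smul_eq_mul]
  rw [this, ← tsum_mul_right]
  refine tsum_congr fun (k : ℕ) => ?_
  change z ^ ((j : ℕ) + (m + 1) * k) * p.coeff ((j : ℕ) + (m + 1) * k) = _
  ring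

/-- Over the series in `u = s ^ m`, with `s` a local coordinate, `ℂ{t}` is spanned by the powers of
`s` with exponents below `m`. -/
theorem exists_coordinate_expansion {u s : OneVar} {m : ℕ} (hm : m ≠ 0) (hs : ord s = 1)
    (hu : s ^ m = u) (hu0 : evalZero u = 0) (g : OneVar) :
    ∃ G : Fin m → OneVar, g = ∑ j, subst u hu0 (G j) * s ^ (j : ℕ) := by
  obtain ⟨hs0, T, hT0, hsT, -⟩ := exists_subst_inverse hs
  obtain ⟨G, hG⟩ := exists_residue_expansion hm (subst T hT0 g)
  refine ⟨G, ?_⟩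
  have h := congrArg (subst s hs0) hG
  rw [subst_subst, subst_congr hsT, subst_tVar_left, map_sum] at h
  refine h.trans (Finset.sum_congr rfl fun j _ => ?_)
  rw [map_mul, map_pow, subst_tVar, subst_subst]
  congr 1
  exact subst_congr (by rw [map_pow, subst_tVar, hu]) _ _

/-! ### Pullbacks along parametrizations -/

namespace MapGerm

variable (φ : MapGerm)

@[simp] theorem evalZero_pullback (h : TwoVar) : evalZero (φ.pullback h) = evalZero h := by
  obtain ⟨f, hf, rfl⟩ := exists_eq_mkGerm h
  change f (φ.toFun 0) = f 0
  rw [φ.map_zero]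

@[simp] theorem pullback_constGerm (c : ℂ) :
    φ.pullback (constGerm _ c) = constGerm ℂ c := rfl

@[simp] theorem evalZero_coordX : evalZero coordX = 0 := rfl

@[simp] theorem evalZero_coordY : evalZero coordY = 0 := rfl

/-- A parametrization that is a series in some `w` of order at least two is not primitive. -/
theorem IsPrimitive.not_subst {φ : MapGerm} (hφ : φ.IsPrimitive) {w : OneVar} (hw : 2 ≤ ord w)
    (hw0 : evalZero w = 0) {F G : OneVar} (hF : φ.pullback coordX = subst w hw0 F) :
    φ.pullback coordY ≠ subst w hw0 G := by
  intro hG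
  have hF0 := congrArg evalZero hF
  have hG0 := congrArg evalZero hG
  rw [evalZero_pullback, evalZero_subst] at hF0 hG0
  obtain ⟨f, hf, rfl⟩ := exists_eq_mkGerm F
  obtain ⟨g, hg, rfl⟩ := exists_eq_mkGerm G
  obtain ⟨ρ, hρ, rfl⟩ := exists_eq_mkGerm w
  have hx : AnalyticAt ℂ φ.x 0 := analyticAt_fst.comp φ.analyticAt
  have hy : AnalyticAt ℂ φ.y 0 := analyticAt_snd.comp φ.analyticAt
  have h1 : φ.x =ᶠ[𝓝 0] f ∘ ρ :=
    (mkGerm_eq_iff (hf := hx) (hg := comp_analyticAt hf hρ hw0)).1 hF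
  have h2 : φ.y =ᶠ[𝓝 0] g ∘ ρ :=
    (mkGerm_eq_iff (hf := hy) (hg := comp_analyticAt hg hρ hw0)).1 hG
  refine hφ ⟨⟨fun z => (f z, g z), hf.prod hg, Prod.ext hF0.symm hG0.symm⟩, ρ, hρ, hw0, hw, ?_⟩
  filter_upwards [h1, h2] with z hz1 hz2
  exact Prod.ext hz1 hz2

theorem IsPrimitive.ne_zero {φ : MapGerm} (hφ : φ.IsPrimitive)
    (hx : φ.pullback coordX = 0) : φ.pullback coordY ≠ 0 := by
  intro hy
  have h2 : evalZero (tVar ^ 2) = 0 := evalZero_pow_eq_zero evalZero_tVar two_ne_zero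
  exact hφ.not_subst (w := tVar ^ 2) (by simp) h2 (F := 0) (G := 0) (by simpa using hx)
    (by simpa using hy)

theorem subst_pullback_congr {φ ψ : MapGerm} {u v : OneVar} {hu : evalZero u = 0}
    {hv : evalZero v = 0}
    (hx : subst u hu (φ.pullback coordX) = subst v hv (ψ.pullback coordX))
    (hy : subst u hu (φ.pullback coordY) = subst v hv (ψ.pullback coordY)) (h : TwoVar) :
    subst u hu (φ.pullback h) = subst v hv (ψ.pullback h) := by
  obtain ⟨ρ, hρ, rfl⟩ := exists_eq_mkGerm u
  obtain ⟨σ, hσ, rfl⟩ := exists_eq_mkGerm v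
  obtain ⟨f, hf, rfl⟩ := exists_eq_mkGerm h
  have hρ0 : ρ 0 = 0 := hu
  have hσ0 : σ 0 = 0 := hv
  have hφx : AnalyticAt ℂ φ.x 0 := analyticAt_fst.comp φ.analyticAt
  have hφy : AnalyticAt ℂ φ.y 0 := analyticAt_snd.comp φ.analyticAt
  have hψx : AnalyticAt ℂ ψ.x 0 := analyticAt_fst.comp ψ.analyticAt
  have hψy : AnalyticAt ℂ ψ.y 0 := analyticAt_snd.comp ψ.analyticAt
  have h1 : φ.x ∘ ρ =ᶠ[𝓝 0] ψ.x ∘ σ := (mkGerm_eq_iff (hf := comp_analyticAt hφx hρ hρ0)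
    (hg := comp_analyticAt hψx hσ hσ0)).1 hx
  have h2 : φ.y ∘ ρ =ᶠ[𝓝 0] ψ.y ∘ σ := (mkGerm_eq_iff (hf := comp_analyticAt hφy hρ hρ0)
    (hg := comp_analyticAt hψy hσ hσ0)).1 hy
  have hfφ : AnalyticAt ℂ (f ∘ φ.toFun) 0 := by
    refine AnalyticAt.comp ?_ φ.analyticAt
    rwa [φ.map_zero]
  have hfψ : AnalyticAt ℂ (f ∘ ψ.toFun) 0 := by
    refine AnalyticAt.comp ?_ ψ.analyticAt
    rwa [ψ.map_zero]
  refine (mkGerm_eq_iff (hf := comp_analyticAt hfφ hρ hρ0) (hg := comp_analyticAt hfψ hσ hσ0)).2 ?_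
  filter_upwards [h1, h2] with z hz1 hz2
  exact congrArg f (Prod.ext hz1 hz2)

/-- The restriction of the linear form `X + c Y` to the branch. -/
def linForm (c : ℂ) : OneVar := φ.pullback coordX + constGerm ℂ c * φ.pullback coordY

@[simp] theorem evalZero_linForm (c : ℂ) : evalZero (φ.linForm c) = 0 := by simp [linForm]

/-- Series in a linear form `X + c Y` are restrictions of elements of `ℂ{X, Y}`. -/
theorem exists_pullback_eq_subst (c : ℂ) (a : OneVar) : ∃ A : TwoVar, ∀ φ : MapGerm,
    φ.pullback A = subst (φ.linForm c) (φ.evalZero_linForm c) a := by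
  obtain ⟨f, hf, rfl⟩ := exists_eq_mkGerm a
  have hl : AnalyticAt ℂ (fun p : ℂ × ℂ => p.1 + c * p.2) 0 :=
    analyticAt_fst.add (analyticAt_const.mul analyticAt_snd)
  refine ⟨mkGerm (f ∘ fun p : ℂ × ℂ => p.1 + c * p.2)
    (AnalyticAt.comp (by simpa using hf) hl), fun φ => rfl⟩

theorem IsPrimitive.linForm_eq_zero_unique {φ : MapGerm} (hφ : φ.IsPrimitive) {c c' : ℂ}
    (h : φ.linForm c = 0) (h' : φ.linForm c' = 0) : c = c' := by
  by_contra hne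
  have hy : φ.pullback coordY = 0 := by
    have : constGerm ℂ (c - c') * φ.pullback coordY = 0 := by
      rw [linForm] at h h'
      rw [map_sub]
      linear_combination h - h'
    refine (mul_eq_zero.1 this).resolve_left fun h0 => hne ?_
    have := congrArg evalZero h0
    rw [evalZero_constGerm, _root_.map_zero] at this
    exact sub_eq_zero.1 this
  refine hφ.ne_zero ?_ hy
  rw [linForm, hy, mul_zero, add_zero] at h
  exact h

end MapGerm

/-- A series invariant under `t ↦ η t`, with `η` a primitive `d`-th root of unity, is a series
in `t ^ d`. -/
theorem exists_subst_pow_eq_of_rotation {η : ℂ} {d : ℕ} (hd : d ≠ 0) (hη : IsPrimitiveRoot η d)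
    {Y : OneVar} {h0 : evalZero (constGerm ℂ η * tVar) = 0}
    (hY : subst (constGerm ℂ η * tVar) h0 Y = Y) :
    ∃ G, Y = subst (tVar ^ d) (evalZero_pow_eq_zero evalZero_tVar hd) G := by
  obtain ⟨G, hG⟩ := exists_residue_expansion hd Y
  have hk : ∀ k : ℕ, Y = ∑ j, subst (tVar ^ d) (evalZero_pow_eq_zero evalZero_tVar hd) (G j) *
      (constGerm ℂ ((η ^ (j : ℕ)) ^ k) * tVar ^ (j : ℕ)) := by
    intro k
    induction k with
    | zero => simpa using hG
    | succ k ih =>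
      have h := congrArg (subst (constGerm ℂ η * tVar) h0) ih
      rw [hY, map_sum] at h
      refine h.trans (Finset.sum_congr rfl fun j _ => ?_)
      rw [map_mul, map_mul, map_pow (subst _ h0) tVar, subst_tVar, subst_constGerm, subst_subst]
      congr 1
      · refine subst_congr ?_ _ _
        rw [map_pow, subst_tVar, mul_pow, ← map_pow, hη.pow_eq_one, map_one, one_mul]
      · rw [mul_pow, ← mul_assoc, ← map_pow, ← map_mul, pow_succ]
  have hsum : (d : OneVar) * Y = (d : OneVar) *
      subst (tVar ^ d) (evalZero_pow_eq_zero evalZero_tVar hd) (G ⟨0, Nat.pos_of_ne_zero hd⟩) := by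
    calc (d : OneVar) * Y = ∑ k ∈ Finset.range d, Y := by simp
      _ = ∑ k ∈ Finset.range d, ∑ j,
            subst (tVar ^ d) (evalZero_pow_eq_zero evalZero_tVar hd) (G j) *
            (constGerm ℂ ((η ^ (j : ℕ)) ^ k) * tVar ^ (j : ℕ)) :=
          Finset.sum_congr rfl fun k _ => hk k
      _ = ∑ j, subst (tVar ^ d) (evalZero_pow_eq_zero evalZero_tVar hd) (G j) *
            (constGerm ℂ (∑ k ∈ Finset.range d, (η ^ (j : ℕ)) ^ k) * tVar ^ (j : ℕ)) := by
          rw [Finset.sum_comm]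
          refine Finset.sum_congr rfl fun j _ => ?_
          rw [map_sum, Finset.sum_mul, Finset.mul_sum]
      _ = _ := by
          rw [Finset.sum_eq_single ⟨0, Nat.pos_of_ne_zero hd⟩]
          · simp [mul_comm]
          · intro j _ hj
            have hj0 : (j : ℕ) ≠ 0 := fun h => hj (Fin.ext h)
            have h1 : η ^ (j : ℕ) ≠ 1 := hη.pow_ne_one_of_pos_of_lt hj0 j.2
            have h2 : ∑ k ∈ Finset.range d, (η ^ (j : ℕ)) ^ k = 0 := by
              have := mul_geom_sum (η ^ (j : ℕ)) d
              rw [← pow_mul, mul_comm (j : ℕ), pow_mul, hη.pow_eq_one, one_pow, sub_self] at this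
              exact (mul_eq_zero.1 this).resolve_left (sub_ne_zero.2 h1)
            rw [h2, map_zero]; simp
          · simp
  refine ⟨G ⟨0, Nat.pos_of_ne_zero hd⟩, mul_left_cancel₀ ?_ hsum⟩
  intro h
  have := congrArg evalZero h
  rw [map_natCast, map_zero] at this
  exact hd (by exact_mod_cast this)

/-! ### Conjugate parametrizations -/

theorem evalZero_const_mul_tVar_pow (a : ℂ) {q : ℕ} (hq : q ≠ 0) :
    evalZero (constGerm ℂ a * tVar ^ q) = 0 := by
  rw [map_mul, evalZero_pow_eq_zero evalZero_tVar hq, mul_zero]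

theorem const_mul_tVar_pow_ne_zero {a : ℂ} (ha : a ≠ 0) (q : ℕ) :
    constGerm ℂ a * tVar ^ q ≠ 0 := by
  rw [Ne, ← ord_eq_top, ord_mul, ord_tVar_pow,
    ord_of_isUnit (isUnit_of_evalZero_ne_zero (by simpa using ha)), zero_add]
  exact ENat.natCast_ne_top q

/-- The Puiseux conjugates of a primitive parametrization are pairwise distinct. -/
theorem MapGerm.IsPrimitive.conjugates_ne {φ : MapGerm} (hφ : φ.IsPrimitive) {c : ℂ} {m q : ℕ}
    (hm : m ≠ 0) (hq : q ≠ 0) {s T : OneVar} (hs : ord s = 1) (hu : s ^ m = φ.linForm c)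
    {hs0 : evalZero s = 0} {hT0 : evalZero T = 0} (hsT : subst s hs0 T = tVar)
    {a b : ℂ} (ha : a ^ m = 1) (hb : b ^ m = 1) (hab : a ≠ b) :
    subst _ (evalZero_const_mul_tVar_pow a hq) (subst T hT0 (φ.pullback coordY)) ≠
      subst _ (evalZero_const_mul_tVar_pow b hq) (subst T hT0 (φ.pullback coordY)) := by
  intro heq
  have ha0 : a ≠ 0 := by rintro rfl; simp [hm] at ha
  have hq0 : evalZero (tVar ^ q) = 0 := evalZero_pow_eq_zero evalZero_tVar hq
  have h1 : ∀ e : ℂ, evalZero (constGerm ℂ e * tVar) = 0 := by simp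
  have hsplit : ∀ (e : ℂ) (Y : OneVar), subst _ (evalZero_const_mul_tVar_pow e hq) Y =
      subst _ hq0 (subst _ (h1 e) Y) := by
    intro e Y
    rw [subst_subst]
    exact subst_congr (by simp) _ _
  set Y := subst T hT0 (φ.pullback coordY) with hYdef
  rw [hsplit, hsplit] at heq
  have heq := subst_injective _ hq0 (by simpa using const_mul_tVar_pow_ne_zero one_ne_zero q) heq
  have hrot : ∀ e : ℂ, subst _ (h1 a⁻¹) (subst _ (h1 e) Y) = subst _ (h1 (e * a⁻¹)) Y := by
    intro e
    rw [subst_subst]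
    refine subst_congr ?_ _ _
    rw [map_mul, subst_constGerm, subst_tVar, ← mul_assoc, ← map_mul]
  have hY := congrArg (subst _ (h1 a⁻¹)) heq
  rw [hrot, hrot] at hY
  have hone : subst _ (h1 (a * a⁻¹)) Y = Y := by
    rw [subst_congr (v := tVar) (by rw [mul_inv_cancel₀ ha0, map_one, one_mul]), subst_tVar_left]
  rw [hone] at hY
  set η := b * a⁻¹ with hη
  have hηm : η ^ m = 1 := by rw [hη, mul_pow, inv_pow, ha, hb]; simp
  have hη1 : η ≠ 1 := by
    intro h
    exact hab (by rw [hη, mul_inv_eq_one₀ ha0] at h; exact h.symm)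
  have hdm : orderOf η ∣ m := orderOf_dvd_of_pow_eq_one hηm
  have hd0 : orderOf η ≠ 0 := fun h => hm (by rwa [h, zero_dvd_iff] at hdm)
  have hd1 : orderOf η ≠ 1 := fun h => hη1 (orderOf_eq_one_iff.1 h)
  obtain ⟨G, hG⟩ := exists_subst_pow_eq_of_rotation hd0 (IsPrimitiveRoot.orderOf η) hY.symm
  obtain ⟨k, hk⟩ := hdm
  have hw0 : evalZero (s ^ orderOf η) = 0 := evalZero_pow_eq_zero hs0 hd0
  have hy : φ.pullback coordY = subst (s ^ orderOf η) hw0 G := by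
    have := congrArg (subst s hs0) hG
    rw [hYdef, subst_subst, subst_congr hsT, subst_tVar_left, subst_subst] at this
    rw [this]
    exact subst_congr (by rw [map_pow, subst_tVar]) _ _
  refine hφ.not_subst (w := s ^ orderOf η) ?_ hw0 (F := tVar ^ k - constGerm ℂ c * G) ?_ hy
  · rw [ord_pow, hs, mul_one]
    exact_mod_cast (by omega : 2 ≤ orderOf η)
  · rw [map_sub, map_mul, subst_constGerm, map_pow, subst_tVar, ← hy, ← pow_mul, ← hk, hu,
      MapGerm.linForm]
    ring

namespace Multigerm

variable {r : ℕ} (φ : Multigerm r)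

/-- A linear form `X + c Y` that vanishes on no branch. -/
theorem exists_linForm_ne_zero : ∃ c : ℂ, ∀ i, (φ.branch i).linForm c ≠ 0 := by
  have hfin : (⋃ i, {c : ℂ | (φ.branch i).linForm c = 0}).Finite :=
    Set.finite_iUnion fun i => Set.Subsingleton.finite fun c hc c' hc' =>
      (φ.primitive i).linForm_eq_zero_unique hc hc'
  obtain ⟨c, hc⟩ := hfin.exists_notMem
  exact ⟨c, fun i hi => hc (Set.mem_iUnion.2 ⟨i, hi⟩)⟩

/-- If `X + c Y` restricts to `sᵢ ^ mᵢ` on the `i`-th branch, then the powers `1, Y, …` with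
exponents below `∑ mᵢ` are linearly independent over the series in `X + c Y`: their restrictions
are determined by the `∑ mᵢ` distinct conjugates of `Y`, so the matrix of the conjugates of the
powers is a nonsingular Vandermonde matrix. -/
theorem eq_zero_of_sum_eq_zero {c : ℂ} {m : Fin r → ℕ} (hm : ∀ i, m i ≠ 0) {s : Fin r → OneVar}
    (hs : ∀ i, ord (s i) = 1) (hu : ∀ i, s i ^ m i = (φ.branch i).linForm c) {n : ℕ}
    (e : Fin n ≃ Σ i, Fin (m i)) {a : Fin n → OneVar}
    (ha : ∀ i, ∑ k, subst _ ((φ.branch i).evalZero_linForm c) (a k) *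
      (φ.branch i).pullback coordY ^ (k : ℕ) = 0) : a = 0 := by
  choose hs0 T hT0 hsT hTs using fun i => exists_subst_inverse (hs i)
  set L := ∏ i, m i
  have hL : L ≠ 0 := Finset.prod_ne_zero_iff.2 fun i _ => hm i
  choose q hqL using fun i => (Finset.dvd_prod_of_mem m (Finset.mem_univ i) : m i ∣ L)
  have hq : ∀ i, q i ≠ 0 := fun i h => hL ((hqL i).trans (by rw [h, mul_zero]))
  have hL0 : evalZero (tVar ^ L) = 0 := evalZero_pow_eq_zero evalZero_tVar hL
  have hζ : ∀ i, IsPrimitiveRoot (Complex.exp (2 * Real.pi * Complex.I / m i)) (m i) :=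
    fun i => Complex.isPrimitiveRoot_exp _ (hm i)
  set ζ : Fin r → ℂ := fun i => Complex.exp (2 * Real.pi * Complex.I / m i)
  have hroot : ∀ i (l : ℕ), (ζ i ^ l) ^ m i = 1 := fun i l => by
    rw [← pow_mul, mul_comm, pow_mul, (hζ i).pow_eq_one, one_pow]
  -- substituting a conjugate parametrization turns `X + c Y` into `t ^ L`
  have hconj : ∀ i (l : ℕ) (g : OneVar),
      subst _ (evalZero_const_mul_tVar_pow (ζ i ^ l) (hq i)) (subst (T i) (hT0 i)
        (subst _ ((φ.branch i).evalZero_linForm c) g)) = subst _ hL0 g := by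
    intro i l g
    rw [subst_subst (T i), subst_subst]
    refine subst_congr ?_ _ _
    rw [← hu i, map_pow (subst (T i) (hT0 i)), hTs, map_pow (subst _ _) tVar, subst_tVar, mul_pow,
      ← map_pow (constGerm ℂ), hroot, map_one, one_mul, ← pow_mul, mul_comm, ← hqL]
  set v : (Σ i, Fin (m i)) → OneVar := fun p =>
    subst _ (evalZero_const_mul_tVar_pow (ζ p.1 ^ (p.2 : ℕ)) (hq p.1))
      (subst (T p.1) (hT0 p.1) ((φ.branch p.1).pullback coordY)) with hv
  have hker : ∀ i j (l l' : ℕ),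
      subst _ (evalZero_const_mul_tVar_pow (ζ i ^ l) (hq i))
        (subst (T i) (hT0 i) ((φ.branch i).pullback coordY)) =
      subst _ (evalZero_const_mul_tVar_pow (ζ j ^ l') (hq j))
        (subst (T j) (hT0 j) ((φ.branch j).pullback coordY)) → i = j := by
    intro i j l l' h
    by_contra hij
    have hlin : ∀ i (l : ℕ), subst _ (evalZero_const_mul_tVar_pow (ζ i ^ l) (hq i))
        (subst (T i) (hT0 i) ((φ.branch i).linForm c)) = tVar ^ L := fun i l => by
      have := hconj i l tVar
      rwa [subst_tVar, subst_tVar] at this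
    have hX := (hlin i l).trans (hlin j l').symm
    rw [MapGerm.linForm, MapGerm.linForm] at hX
    simp only [map_add, map_mul, subst_constGerm] at hX
    rw [h] at hX
    have hX := add_right_cancel hX
    rw [subst_subst, subst_subst] at hX h
    have hcongr := MapGerm.subst_pullback_congr hX h
    have hinj : ∀ i (l : ℕ) (g : OneVar),
        subst (subst _ (evalZero_const_mul_tVar_pow (ζ i ^ l) (hq i)) (T i))
          (by rw [evalZero_subst]; exact hT0 i) g = 0 ↔ g = 0 := by
      intro i l g
      have hinv : Function.Injective (subst (T i) (hT0 i)) :=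
        subst_injective _ _ fun h0 => by
          have := hsT i
          rw [h0, map_zero] at this
          exact const_mul_tVar_pow_ne_zero one_ne_zero 1 (by simpa using this.symm)
      rw [← subst_subst (hv := hT0 i), map_eq_zero_iff _ (subst_injective _ _
        (const_mul_tVar_pow_ne_zero (pow_ne_zero _ ((hζ i).ne_zero (hm i))) _)),
        map_eq_zero_iff _ hinv]
    refine φ.distinct i j hij (Ideal.ext fun h => ?_)
    rw [RingHom.mem_ker, RingHom.mem_ker, ← hinj i l, hcongr h, hinj j l']
  have hvinj : Function.Injective v := by
    rintro ⟨i, l⟩ ⟨j, l'⟩ h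
    obtain rfl := hker i j l l' h
    by_contra hne
    have hll : (l : ℕ) ≠ l' := fun h => hne (by rw [Fin.ext h])
    exact (φ.primitive i).conjugates_ne (hm i) (hq i) (hs i) (hu i) (hsT i) (hroot i l) (hroot i l')
      (fun h => hll ((hζ i).pow_inj l.2 l'.2 h)) h
  have hzero : Matrix.vandermonde (v ∘ e) *ᵥ (fun k => subst _ hL0 (a k)) = 0 := by
    funext p
    rcases hp : e p with ⟨i, l⟩
    have := congrArg ((subst _ (evalZero_const_mul_tVar_pow (ζ i ^ (l : ℕ)) (hq i))).comp
      (subst (T i) (hT0 i))) (ha i)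
    rw [map_sum, map_zero] at this
    rw [Pi.zero_apply, ← this]
    simp only [Matrix.mulVec, dotProduct, Matrix.vandermonde_apply, Function.comp_apply, hp]
    refine Finset.sum_congr rfl fun k _ => ?_
    rw [map_mul, RingHom.comp_apply, hconj, map_pow, mul_comm]
    rfl
  have ha0 := Matrix.eq_zero_of_mulVec_eq_zero
    (Matrix.det_vandermonde_ne_zero_iff.2 (hvinj.comp e.injective)) hzero
  funext k
  refine subst_injective _ hL0 (by simpa using const_mul_tVar_pow_ne_zero one_ne_zero L) ?_
  rw [Pi.zero_apply, map_zero]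
  exact congrFun ha0 k

end Multigerm

/-! ### Finiteness of the conductor -/

namespace Multigerm

variable {r : ℕ} (φ : Multigerm r)

/-- `𝒪` contains all tuples of sufficiently large order. -/
theorem exists_forall_le_ord_mem_localRing :
    ∃ N : ℕ, ∀ p : Fin r → OneVar, (∀ i, (N : ℕ∞) ≤ ord (p i)) → p ∈ φ.localRing := by
  obtain ⟨c, hc⟩ := φ.exists_linForm_ne_zero
  choose m hmord using fun i => ENat.ne_top_iff_exists.1 (ord_eq_top.not.2 (hc i))
  have hm : ∀ i, m i ≠ 0 := by
    intro i h
    have h1 : 1 ≤ ord ((φ.branch i).linForm c) := one_le_ord.2 (MapGerm.evalZero_linForm _ _)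
    rw [← hmord i, h] at h1
    simp at h1
  choose s hs hu using fun i => exists_pow_eq_of_ord_eq (hm i) (hmord i).symm
  let I := Σ i, Fin (m i)
  let n := Fintype.card I
  let e : Fin n ≃ I := (Fintype.equivFin I).symm
  let A : ∀ i, OneVar →+* OneVar := fun i => subst _ ((φ.branch i).evalZero_linForm c)
  let y : Fin r → OneVar := fun i => (φ.branch i).pullback coordY
  have hexp : ∀ i (g : OneVar), ∃ G : Fin (m i) → OneVar, g = ∑ j, A i (G j) * s i ^ (j : ℕ) :=
    fun i g => exists_coordinate_expansion (hm i) (hs i) (hu i) _ g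
  choose G hG using hexp
  -- the coordinates of the powers of `Y` in the basis of the `sᵢ ^ j`
  let B : Fin n → I → OneVar := fun k q => G q.1 (y q.1 ^ (k : ℕ)) q.2
  let M : Matrix (Fin n) (Fin n) OneVar := Matrix.of fun k p => B k (e p)
  have hM : ∀ (w : Fin n → OneVar) (i : Fin r), ∑ k, A i (w k) * y i ^ (k : ℕ) =
      ∑ j, A i ((w ᵥ* M) (e.symm ⟨i, j⟩)) * s i ^ (j : ℕ) := by
    intro w i
    calc ∑ k, A i (w k) * y i ^ (k : ℕ)
        = ∑ k, A i (w k) * ∑ j, A i (G i (y i ^ (k : ℕ)) j) * s i ^ (j : ℕ) :=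
          Finset.sum_congr rfl fun k _ => by rw [← hG]
      _ = ∑ j, ∑ k, A i (w k) * (A i (G i (y i ^ (k : ℕ)) j) * s i ^ (j : ℕ)) := by
          simp only [Finset.mul_sum]
          rw [Finset.sum_comm]
      _ = _ := by
          refine Finset.sum_congr rfl fun j _ => ?_
          have hB : ∀ k, M k (e.symm ⟨i, j⟩) = G i (y i ^ (k : ℕ)) j := fun k =>
            congrArg (B k) (e.apply_symm_apply ⟨i, j⟩)
          simp only [Matrix.vecMul, dotProduct, map_sum, Finset.sum_mul, hB, map_mul, mul_assoc]
  have hdet : M.det ≠ 0 := by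
    intro h0
    obtain ⟨w, hw, hwM⟩ := Matrix.exists_vecMul_eq_zero_iff.2 h0
    refine hw (φ.eq_zero_of_sum_eq_zero hm hs hu e fun i => (hM w i).trans ?_)
    simp [hwM]
  have hAdet : ∀ i, A i M.det ≠ 0 := fun i =>
    (map_ne_zero_iff _ (subst_injective _ _ (hc i))).2 hdet
  choose d hd using fun i => ENat.ne_top_iff_exists.1 (ord_eq_top.not.2 (hAdet i))
  refine ⟨∑ i, d i, fun p hp => ?_⟩
  have hdvd : ∀ i, A i M.det ∣ p i := by
    intro i
    refine dvd_of_ord_le ?_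
    rw [← hd i]
    refine le_trans ?_ (hp i)
    exact_mod_cast Finset.single_le_sum (f := d) (fun _ _ => Nat.zero_le _) (Finset.mem_univ i)
  choose p' hp' using hdvd
  let b' : I → OneVar := fun q => G q.1 (p' q.1) q.2
  let b : Fin n → OneVar := fun k => b' (e k)
  -- Cramer's rule
  let w : Fin n → OneVar := b ᵥ* M.adjugate
  have hwM : w ᵥ* M = M.det • b := by
    rw [Matrix.vecMul_vecMul, Matrix.adjugate_mul, Matrix.vecMul_smul, Matrix.vecMul_one]
  choose W hW using fun k => MapGerm.exists_pullback_eq_subst c (w k)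
  refine ⟨∑ k, W k * coordY ^ (k : ℕ), funext fun i => ?_⟩
  change (φ.branch i).pullback _ = _
  rw [map_sum]
  have h1 : ∑ k, (φ.branch i).pullback (W k * coordY ^ (k : ℕ)) =
      ∑ k, A i (w k) * y i ^ (k : ℕ) :=
    Finset.sum_congr rfl fun k _ => by rw [map_mul, map_pow, hW]
  rw [h1, hM, hwM, hp' i, hG i (p' i), Finset.mul_sum]
  refine Finset.sum_congr rfl fun j _ => ?_
  have h2 : b (e.symm ⟨i, j⟩) = G i (p' i) j :=
    congrArg b' (e.apply_symm_apply ⟨i, j⟩)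
  rw [Pi.smul_apply, smul_eq_mul, h2, map_mul, mul_assoc]

end Multigerm

/-! ### Local coordinates in `ℂ{X, Y}` and multiplicities -/

/-- The division `f = f(0) + X a + Y b`, obtained by splitting off one argument of each term of the
power series of `f`. -/
theorem exists_eq_const_add (f : TwoVar) :
    ∃ a b : TwoVar, f = constGerm _ (evalZero f) + coordX * a + coordY * b := by
  obtain ⟨f, hf, rfl⟩ := exists_eq_mkGerm f
  obtain ⟨p, R, hp⟩ := id hf
  have hr : 0 < p.shift.radius := by
    rw [FormalMultilinearSeries.radius_shift]
    exact hp.r_pos.trans_le hp.r_le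
  have hA := p.shift.hasFPowerSeriesOnBall hr
  set A := p.shift.sum
  have han : ∀ v : ℂ × ℂ, AnalyticAt ℂ (fun z => A z v) 0 := fun v =>
    ((ContinuousLinearMap.apply ℂ ℂ v).analyticAt _).comp hA.analyticAt
  refine ⟨mkGerm _ (han (1, 0)), mkGerm _ (han (0, 1)), ?_⟩
  refine (mkGerm_eq_iff (hg := (analyticAt_const.add (analyticAt_fst.mul (han (1, 0)))).add
    (analyticAt_snd.mul (han (0, 1))))).2 ?_
  filter_upwards [Metric.eball_mem_nhds (0 : ℂ × ℂ) hp.r_pos, Metric.eball_mem_nhds (0 : ℂ × ℂ) hr]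
    with z hz hz'
  have h1 := hp.hasSum hz
  rw [zero_add] at h1
  have h2 := (hA.hasSum hz').mapL ((ContinuousLinearMap.apply ℂ ℂ) z)
  rw [zero_add] at h2
  have h3 : HasSum (fun n => p (n + 1) fun _ => z) (A z z) := by
    refine h2.congr_fun fun n => ?_
    change p (n + 1) _ = (p (n + 1)).curryRight (fun _ => z) z
    rw [ContinuousMultilinearMap.curryRight_apply]
    congr 1
    funext i
    refine Fin.lastCases ?_ (fun j => ?_) i <;> simp
  have h4 := (hasSum_nat_add_iff' (f := fun n => p n fun _ => z) 1).2 h1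
  have h5 := h4.unique h3
  rw [Finset.sum_range_one] at h5
  have h6 : (p 0 fun _ => z) = f 0 := hp.coeff_zero _
  rw [h6] at h5
  have h7 : A z z = z.1 * A z (1, 0) + z.2 * A z (0, 1) := by
    have : z = z.1 • ((1, 0) : ℂ × ℂ) + z.2 • ((0, 1) : ℂ × ℂ) := by ext <;> simp
    refine (congrArg (A z) this).trans ?_
    rw [map_add, map_smul, map_smul, smul_eq_mul, smul_eq_mul]
  change f z = f 0 + z.1 * A z (1, 0) + z.2 * A z (0, 1)
  linear_combination h5 + h7

theorem coordX_mem : coordX ∈ maxIdeal := Ideal.subset_span (by simp)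

theorem coordY_mem : coordY ∈ maxIdeal := Ideal.subset_span (by simp)

theorem mem_maxIdeal_iff {f : TwoVar} : f ∈ maxIdeal ↔ evalZero f = 0 := by
  constructor
  · intro h
    have hle : maxIdeal ≤ RingHom.ker (evalZero (E := ℂ × ℂ)) := by
      rw [maxIdeal, Ideal.span_le]
      rintro g (rfl | rfl) <;> rfl
    exact hle h
  · intro h
    obtain ⟨a, b, hab⟩ := exists_eq_const_add f
    rw [hab, h, map_zero, zero_add]
    exact maxIdeal.add_mem (maxIdeal.mul_mem_right _ coordX_mem)
      (maxIdeal.mul_mem_right _ coordY_mem)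

theorem mul_mem_maxIdeal_sq {f g : TwoVar} (hf : evalZero f = 0) (hg : evalZero g = 0) :
    f * g ∈ maxIdeal ^ 2 := by
  rw [pow_two]
  exact Ideal.mul_mem_mul (mem_maxIdeal_iff.2 hf) (mem_maxIdeal_iff.2 hg)

theorem pow_mem_maxIdeal_sq {f : TwoVar} (hf : evalZero f = 0) {k : ℕ} (hk : 2 ≤ k) :
    f ^ k ∈ maxIdeal ^ 2 :=
  Ideal.pow_le_pow_right hk (Ideal.pow_mem_pow (mem_maxIdeal_iff.2 hf) k)

/-- The linear part of a germ without constant term. -/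
theorem exists_linear_part {h : TwoVar} (h0 : evalZero h = 0) :
    ∃ a b : ℂ, ∃ g ∈ maxIdeal ^ 2, h = constGerm _ a * coordX + constGerm _ b * coordY + g := by
  obtain ⟨A, B, hAB⟩ := exists_eq_const_add h
  rw [h0, map_zero, zero_add] at hAB
  refine ⟨evalZero A, evalZero B, coordX * (A - constGerm _ (evalZero A)) +
    coordY * (B - constGerm _ (evalZero B)), ?_, by rw [hAB]; ring⟩
  exact Ideal.add_mem _ (mul_mem_maxIdeal_sq rfl (by simp)) (mul_mem_maxIdeal_sq rfl (by simp))

/-- `Z` and `h` generate the maximal ideal of `ℂ{X, Y}`, that is, they are local coordinates. -/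
structure IsCoordPair (Z h : TwoVar) : Prop where
  left : evalZero Z = 0
  right : evalZero h = 0
  exists_eq : ∀ f : TwoVar, ∃ a b : TwoVar, f = constGerm _ (evalZero f) + Z * a + h * b

theorem isCoordPair_coord : IsCoordPair coordX coordY := ⟨rfl, rfl, exists_eq_const_add⟩

namespace IsCoordPair

variable {Z W h : TwoVar}

theorem symm (H : IsCoordPair Z h) : IsCoordPair h Z := by
  refine ⟨H.right, H.left, fun f => ?_⟩
  obtain ⟨a, b, hab⟩ := H.exists_eq f
  exact ⟨b, a, by rw [add_right_comm]; exact hab⟩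

theorem replace_right (H : IsCoordPair Z W) {A B : TwoVar} (hB : IsUnit B) :
    IsCoordPair Z (Z * A + W * B) := by
  refine ⟨H.left, by simp [H.left, H.right], fun f => ?_⟩
  obtain ⟨a, b, hab⟩ := H.exists_eq f
  obtain ⟨B, rfl⟩ := hB
  refine ⟨a - A * ↑B⁻¹ * b, ↑B⁻¹ * b, hab.trans ?_⟩
  have : (B : TwoVar) * ↑B⁻¹ = 1 := B.mul_inv
  linear_combination (-W * b) * this

/-- Expansion with respect to local coordinates: up to a multiple of `h`, every germ is either a
unit times a power of `Z`, or divisible by a given power of `Z`. -/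
theorem exists_eq_pow_mul_add (H : IsCoordPair Z h) (N : ℕ) (f : TwoVar) :
    ∃ k ≤ N, ∃ u b : TwoVar, f = Z ^ k * u + h * b ∧ (k < N → IsUnit u) := by
  induction N with
  | zero => exact ⟨0, le_rfl, f, 0, by simp, by simp⟩
  | succ N ih =>
    obtain ⟨k, hk, u, b, hf, hu⟩ := ih
    by_cases hunit : IsUnit u
    · exact ⟨k, hk.trans (Nat.le_succ N), u, b, hf, fun _ => hunit⟩
    · obtain rfl : k = N := by
        by_contra hne
        exact hunit (hu (lt_of_le_of_ne hk hne))
      obtain ⟨u', b', hu'⟩ := H.exists_eq u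
      rw [isUnit_iff_evalZero_ne_zero, not_not] at hunit
      rw [hunit, map_zero, zero_add] at hu'
      refine ⟨k + 1, le_rfl, u', b + Z ^ k * b', ?_, by simp⟩
      rw [hf, hu']
      ring

end IsCoordPair

/-- A germ of order one is part of a system of local coordinates. -/
theorem exists_isCoordPair {h : TwoVar} (h0 : evalZero h = 0) (h2 : h ∉ maxIdeal ^ 2) :
    ∃ Z, IsCoordPair Z h := by
  obtain ⟨A, B, hAB⟩ := exists_eq_const_add h
  rw [h0, map_zero, zero_add] at hAB
  by_cases hB : IsUnit B
  · exact ⟨coordX, hAB ▸ isCoordPair_coord.replace_right hB⟩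
  by_cases hA : IsUnit A
  · refine ⟨coordY, ?_⟩
    rw [hAB, add_comm]
    exact isCoordPair_coord.symm.replace_right hA
  rw [isUnit_iff_evalZero_ne_zero, not_not] at hA hB
  refine absurd ?_ h2
  rw [hAB]
  exact Ideal.add_mem _ (mul_mem_maxIdeal_sq rfl hA) (mul_mem_maxIdeal_sq rfl hB)

theorem IsCoordPair.exists_eq_of_mem_sq {Z W g : TwoVar} (H : IsCoordPair Z W)
    (hg : g ∈ maxIdeal ^ 2) :
    ∃ A B : TwoVar, evalZero A = 0 ∧ evalZero B = 0 ∧ g = Z * A + W * B := by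
  rw [pow_two] at hg
  refine Submodule.mul_induction_on hg ?_ ?_
  · intro p hp q hq
    obtain ⟨A, B, hAB⟩ := H.exists_eq p
    rw [mem_maxIdeal_iff] at hp hq
    rw [hp, map_zero, zero_add] at hAB
    exact ⟨A * q, B * q, by rw [map_mul, hq, mul_zero], by rw [map_mul, hq, mul_zero],
      by rw [hAB]; ring⟩
  · rintro p q ⟨A, B, hA, hB, rfl⟩ ⟨A', B', hA', hB', rfl⟩
    exact ⟨A + A', B + B', by rw [map_add, hA, hA', add_zero], by rw [map_add, hB, hB', add_zero],
      by ring⟩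

theorem isCoordPair_of_linear_part {a b : ℂ} (hb : b ≠ 0) {g : TwoVar} (hg : g ∈ maxIdeal ^ 2) :
    IsCoordPair coordX (constGerm _ a * coordX + constGerm _ b * coordY + g) := by
  obtain ⟨A, B, -, hB, rfl⟩ := isCoordPair_coord.exists_eq_of_mem_sq hg
  have := isCoordPair_coord.replace_right (A := constGerm _ a + A) (B := constGerm _ b + B)
    (isUnit_of_evalZero_ne_zero (by simpa [hB] using hb))
  convert this using 1
  ring

namespace MapGerm

variable {φ : MapGerm}

theorem ord_pullback_of_isUnit {u : TwoVar} (hu : IsUnit u) : ord (φ.pullback u) = 0 :=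
  ord_of_isUnit (hu.map _)

theorem IsPrimitive.coe_mult (hφ : φ.IsPrimitive) :
    (φ.mult : ℕ∞) = min (ord (φ.pullback coordX)) (ord (φ.pullback coordY)) := by
  refine ENat.natCast_toNat ?_
  change min (ord (φ.pullback coordX)) (ord (φ.pullback coordY)) ≠ ⊤
  intro h
  rw [min_eq_top, ord_eq_top, ord_eq_top] at h
  exact hφ.ne_zero h.1 h.2

theorem IsPrimitive.mult_ne_zero (hφ : φ.IsPrimitive) : φ.mult ≠ 0 := by
  intro h
  have h1 : (1 : ℕ∞) ≤ φ.mult := by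
    rw [hφ.coe_mult]
    exact le_min (one_le_ord.2 (by simp)) (one_le_ord.2 (by simp))
  rw [h] at h1
  simp at h1

theorem IsPrimitive.mult_le_ord_pullback (hφ : φ.IsPrimitive) {f : TwoVar} (hf : evalZero f = 0) :
    (φ.mult : ℕ∞) ≤ ord (φ.pullback f) := by
  obtain ⟨a, b, hab⟩ := exists_eq_const_add f
  rw [hab, hf, _root_.map_zero, zero_add, map_add, map_mul, map_mul, hφ.coe_mult]
  exact le_ord_add (le_ord_mul_right _ (min_le_left _ _)) (le_ord_mul_right _ (min_le_right _ _))

theorem IsPrimitive.two_mul_mult_le_ord_pullback (hφ : φ.IsPrimitive) {f : TwoVar}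
    (hf : f ∈ maxIdeal ^ 2) : ((2 * φ.mult : ℕ) : ℕ∞) ≤ ord (φ.pullback f) := by
  rw [pow_two] at hf
  refine Submodule.mul_induction_on hf ?_ ?_
  · intro p hp q hq
    rw [mem_maxIdeal_iff] at hp hq
    rw [map_mul, ord_mul, two_mul, Nat.cast_add]
    exact add_le_add (hφ.mult_le_ord_pullback hp) (hφ.mult_le_ord_pullback hq)
  · intro p q hp hq
    rw [map_add]
    exact le_ord_add hp hq

theorem iteratedDeriv_mult_eq_zero {f : ℂ → ℂ} (hf : AnalyticAt ℂ f 0) {n : ℕ}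
    (hn : (n : ℕ∞) ≤ analyticOrderAt f 0) :
    iteratedDeriv n f 0 = 0 ↔ (n : ℕ∞) < analyticOrderAt f 0 := by
  rw [← ENat.add_one_le_iff (ENat.natCast_ne_top n), ← Nat.cast_one, ← Nat.cast_add,
    natCast_le_analyticOrderAt_iff_iteratedDeriv_eq_zero hf]
  rw [natCast_le_analyticOrderAt_iff_iteratedDeriv_eq_zero hf] at hn
  refine ⟨fun h i hi => ?_, fun h => h n (Nat.lt_succ_self n)⟩
  rcases Nat.lt_succ_iff_lt_or_eq.1 hi with h' | rfl
  exacts [hn i h', h]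

theorem IsPrimitive.leadX_eq_zero_iff (hφ : φ.IsPrimitive) :
    φ.leadX = 0 ↔ (φ.mult : ℕ∞) < ord (φ.pullback coordX) := by
  have hx : AnalyticAt ℂ φ.x 0 := analyticAt_fst.comp φ.analyticAt
  rw [leadX, div_eq_zero_iff, or_iff_left (by exact_mod_cast Nat.factorial_ne_zero _)]
  exact iteratedDeriv_mult_eq_zero hx (hφ.coe_mult.trans_le (min_le_left _ _))

theorem IsPrimitive.leadY_eq_zero_iff (hφ : φ.IsPrimitive) :
    φ.leadY = 0 ↔ (φ.mult : ℕ∞) < ord (φ.pullback coordY) := by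
  have hy : AnalyticAt ℂ φ.y 0 := analyticAt_snd.comp φ.analyticAt
  rw [leadY, div_eq_zero_iff, or_iff_left (by exact_mod_cast Nat.factorial_ne_zero _)]
  exact iteratedDeriv_mult_eq_zero hy (hφ.coe_mult.trans_le (min_le_right _ _))

theorem IsPrimitive.ord_of_slope_eq_zero (hφ : φ.IsPrimitive)
    (h : φ.slope = ((0 : ℂ) : OnePoint ℂ)) :
    ord (φ.pullback coordX) = φ.mult ∧ (φ.mult : ℕ∞) < ord (φ.pullback coordY) := by
  rw [slope] at h
  split_ifs at h with hX
  · exact absurd h (OnePoint.infty_ne_coe _)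
  · rw [OnePoint.coe_eq_coe, div_eq_zero_iff, or_iff_left hX, hφ.leadY_eq_zero_iff] at h
    refine ⟨le_antisymm ?_ (hφ.coe_mult.trans_le (min_le_left _ _)), h⟩
    rwa [hφ.leadX_eq_zero_iff, not_lt] at hX

theorem IsPrimitive.ord_of_slope_eq_infty (hφ : φ.IsPrimitive) (h : φ.slope = OnePoint.infty) :
    ord (φ.pullback coordY) = φ.mult ∧ (φ.mult : ℕ∞) < ord (φ.pullback coordX) := by
  rw [slope] at h
  split_ifs at h with hX
  · have hlt := hφ.leadX_eq_zero_iff.1 hX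
    refine ⟨?_, hlt⟩
    have := hφ.coe_mult
    rcases min_choice (ord (φ.pullback coordX)) (ord (φ.pullback coordY)) with h' | h'
    · rw [this, h'] at hlt
      exact absurd hlt (lt_irrefl _)
    · rw [this, h']
  · exact absurd h (OnePoint.coe_ne_infty _)

end MapGerm

/-! ### Several branches -/

namespace MapGerm

variable {φ ψ : MapGerm}

theorem evalZero_eq_zero_of_ord_ne_zero {h : TwoVar} (hh : ord (φ.pullback h) ≠ 0) :
    evalZero h = 0 := by
  rwa [Ne, ord_eq_zero, evalZero_pullback, not_not] at hh

theorem IsPrimitive.pullback_left_ne_zero (hφ : φ.IsPrimitive) {Z h : TwoVar} (H : IsCoordPair Z h)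
    (h0 : φ.pullback h = 0) : φ.pullback Z ≠ 0 := by
  intro hZ
  have key : ∀ f : TwoVar, evalZero f = 0 → φ.pullback f = 0 := by
    intro f hf
    obtain ⟨a, b, hab⟩ := H.exists_eq f
    rw [hab, hf, _root_.map_zero, zero_add, map_add, map_mul, map_mul, hZ, h0, zero_mul, zero_mul,
      add_zero]
  exact hφ.ne_zero (key _ rfl) (key _ rfl)

/-- If the second of two local coordinates vanishes on a branch, then a germ vanishes on the branch
only if it is divisible by it up to arbitrarily high powers of the first one. -/
theorem IsPrimitive.exists_eq_of_pullback_eq_zero (hφ : φ.IsPrimitive) {Z h f : TwoVar}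
    (H : IsCoordPair Z h) (h0 : φ.pullback h = 0) (hf : φ.pullback f = 0) (N : ℕ) :
    ∃ u b, f = Z ^ N * u + h * b := by
  obtain ⟨k, hk, u, b, hfub, hu⟩ := H.exists_eq_pow_mul_add N f
  rcases hk.lt_or_eq with hlt | rfl
  · rw [hfub, map_add, map_mul, map_mul, h0, zero_mul, add_zero, mul_eq_zero, map_pow] at hf
    rcases hf with hf | hf
    · exact absurd (eq_zero_of_pow_eq_zero hf) (hφ.pullback_left_ne_zero H h0)
    · exact absurd hf ((hu hlt).map φ.pullback).ne_zero
  · exact ⟨u, b, hfub⟩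

/-- Two branches contained in the same smooth germ coincide. -/
theorem IsPrimitive.ker_le_ker (hφ : φ.IsPrimitive) {Z h : TwoVar} (H : IsCoordPair Z h)
    (h0 : φ.pullback h = 0) (h1 : ψ.pullback h = 0) :
    RingHom.ker φ.pullback ≤ RingHom.ker ψ.pullback := by
  intro f hf
  rw [RingHom.mem_ker] at hf ⊢
  rw [← ord_eq_top]
  refine ENat.eq_top_iff_forall_ge.2 fun N => ?_
  obtain ⟨u, b, rfl⟩ := hφ.exists_eq_of_pullback_eq_zero H h0 hf N
  rw [map_add, map_mul, map_mul, h1, zero_mul, add_zero, map_pow]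
  refine le_ord_mul_right _ ?_
  rw [ord_pow]
  have hZ : 1 ≤ ord (ψ.pullback Z) := one_le_ord.2 (by simpa using H.left)
  exact le_mul_of_one_le_right' hZ

/-- On a branch contained in the smooth germ `h = 0`, all values are multiples of that of a
complementary coordinate. -/
theorem dvd_of_ord_eq {Z h f : TwoVar} (H : IsCoordPair Z h)
    (h0 : φ.pullback h = 0) {m v : ℕ} (hm : ord (φ.pullback Z) = m) (hv : ord (φ.pullback f) = v) :
    m ∣ v := by
  obtain ⟨k, hk, u, b, rfl, hu⟩ := H.exists_eq_pow_mul_add (v + 1) f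
  rw [map_add, map_mul, map_mul, h0, zero_mul, add_zero, map_pow, ord_mul, ord_pow, hm] at hv
  rcases hk.lt_or_eq with hlt | rfl
  · rw [ord_pullback_of_isUnit (hu hlt), add_zero] at hv
    exact ⟨k, by rw [mul_comm]; exact_mod_cast hv.symm⟩
  · exfalso
    have hm1 : (1 : ℕ∞) ≤ m := by
      rw [← hm]
      exact one_le_ord.2 (by simpa using H.left)
    have h2 : ((v + 1 : ℕ) : ℕ∞) * m ≤ v := by
      rw [← hv]
      exact le_self_add
    have h3 : (v + 1) * m ≤ v := by exact_mod_cast h2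
    have h4 : 1 ≤ m := by exact_mod_cast hm1
    nlinarith

theorem lt_ord_pullback_of_linear_part (hφ : φ.IsPrimitive)
    (hY : (φ.mult : ℕ∞) < ord (φ.pullback coordY))
    (b : ℂ) {g : TwoVar} (hg : g ∈ maxIdeal ^ 2) :
    ((φ.mult + 1 : ℕ) : ℕ∞) ≤ ord (φ.pullback (constGerm _ b * coordY + g)) := by
  rw [map_add]
  refine le_ord_add ?_ (le_trans ?_ (hφ.two_mul_mult_le_ord_pullback hg))
  · rw [map_mul]
    refine le_ord_mul_left _ ?_
    rw [Nat.cast_add, Nat.cast_one]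
    exact Order.add_one_le_of_lt hY
  · have := hφ.mult_ne_zero
    exact_mod_cast (by omega : φ.mult + 1 ≤ 2 * φ.mult)

/-- On a branch tangent to `Y = 0`, germs with a nonzero `X`-term have minimal value. -/
theorem ord_pullback_of_linear_part (hφ : φ.IsPrimitive)
    (hX : ord (φ.pullback coordX) = φ.mult) (hY : (φ.mult : ℕ∞) < ord (φ.pullback coordY))
    {a b : ℂ} (ha : a ≠ 0) {g : TwoVar} (hg : g ∈ maxIdeal ^ 2) :
    ord (φ.pullback (constGerm _ a * coordX + constGerm _ b * coordY + g)) = φ.mult := by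
  have h1 : ord (φ.pullback (constGerm _ a * coordX)) = φ.mult := by
    rw [map_mul, ord_mul, hX, ord_pullback_of_isUnit (isUnit_of_evalZero_ne_zero (by simpa)),
      zero_add]
  have h2 := lt_ord_pullback_of_linear_part hφ hY b hg
  rw [add_assoc, map_add, ord_add_eq_left, h1]
  rw [h1]
  exact lt_of_lt_of_le (by exact_mod_cast Nat.lt_succ_self _) h2

end MapGerm

namespace Multigerm

variable {r : ℕ} {φ : Multigerm r} {κ : Fin r → ℕ}

namespace IsConductorExponent

theorem isConductorOne (hκ : φ.IsConductorExponent κ) (i : Fin r) {d : ℕ}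
    (h1 : ∀ n : ℕ, d ≤ n → ∃ h ∈ maxIdeal ^ 2, (∀ j, (κ j : ℕ∞) ≤ φ.val j h) ∧ φ.val i h = n)
    (h2 : ∀ n : ℕ, n + 1 = d →
      ∀ h ∈ maxIdeal ^ 2, (∀ j, (κ j : ℕ∞) ≤ φ.val j h) → φ.val i h ≠ n) :
    IsConductorOne (φ.determinacyValues i) d := by
  constructor
  · intro n hn
    rw [hκ.mem_determinacyValues_iff]
    induction n using ENat.recTopCoe with
    | top => exact ⟨0, Ideal.zero_mem _, fun j => by simp [val], by simp [val]⟩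
    | coe n => exact h1 n (by exact_mod_cast hn)
  · intro n hn hmem
    rw [hκ.mem_determinacyValues_iff] at hmem
    obtain ⟨h, hh, hc, hv⟩ := hmem
    induction n using ENat.recTopCoe with
    | top => simp at hn
    | coe n => exact h2 n (by exact_mod_cast hn) h hh hc hv

theorem isConductorOne_self (hκ : φ.IsConductorExponent κ) (i : Fin r)
    (h1 : ∀ n : ℕ, κ i ≤ n → ∃ h ∈ maxIdeal ^ 2, (∀ j, (κ j : ℕ∞) ≤ φ.val j h) ∧ φ.val i h = n) :
    IsConductorOne (φ.determinacyValues i) (κ i) := by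
  refine hκ.isConductorOne i h1 fun n hn h _ hc hv => ?_
  have := hc i
  rw [hv, ← hn] at this
  have : n + 1 ≤ n := by exact_mod_cast this
  omega

theorem exists_val_eq_top (hκ : φ.IsConductorExponent κ) (i : Fin r) {n : ℕ} (hn : κ i ≤ n) :
    ∃ h, φ.val i h = n ∧ ∀ j, j ≠ i → (φ.branch j).pullback h = 0 := by
  obtain ⟨h, hh⟩ := hκ.exists_val_eq (Function.update (fun _ => ⊤) i (n : ℕ∞)) fun j => by
    by_cases hj : j = i
    · subst hj
      rw [Function.update_self]
      exact_mod_cast hn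
    · simp [hj]
  refine ⟨h, by simpa using hh i, fun j hj => ?_⟩
  rw [← ord_eq_top]
  have := hh j
  rwa [Function.update_of_ne hj] at this

/-- With at least three branches, a germ vanishing on all branches but one has order at least
two. -/
theorem isConductorOne_of_three_le (hκ : φ.IsConductorExponent κ) (hr : 3 ≤ r) (i : Fin r) :
    IsConductorOne (φ.determinacyValues i) (κ i) := by
  refine hκ.isConductorOne_self i fun n hn => ?_
  obtain ⟨h, hi, htop⟩ := hκ.exists_val_eq_top i hn
  refine ⟨h, ?_, fun j => ?_, hi⟩
  · obtain ⟨j, hj, k, hk, hjk⟩ : ∃ j, j ≠ i ∧ ∃ k, k ≠ i ∧ j ≠ k := by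
      have hcard : 1 < (Finset.univ.erase i).card := by
        rw [Finset.card_erase_of_mem (Finset.mem_univ _), Finset.card_univ, Fintype.card_fin]
        omega
      obtain ⟨j, hj, k, hk, hjk⟩ := Finset.one_lt_card.1 hcard
      exact ⟨j, Finset.ne_of_mem_erase hj, k, Finset.ne_of_mem_erase hk, hjk⟩
    by_contra h2
    have h0 : evalZero h = 0 := MapGerm.evalZero_eq_zero_of_ord_ne_zero (φ := φ.branch j)
      (by simp [htop j hj])
    obtain ⟨Z, H⟩ := exists_isCoordPair h0 h2
    exact φ.distinct j k hjk (le_antisymm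
      ((φ.primitive j).ker_le_ker H (htop j hj) (htop k hk))
      ((φ.primitive k).ker_le_ker H (htop k hk) (htop j hj)))
  · by_cases hj : j = i
    · subst hj
      rw [hi]
      exact_mod_cast hn
    · rw [val, htop j hj]
      simp

/-- If a germ of order one vanishes on one branch and has a value beyond the conductor on another,
then both branches are smooth. The `j`-th one is, as all values on it are multiples of the value of
a complementary coordinate. On the `i`-th one, the next value is taken by a germ vanishing on the
`j`-th branch, which is a multiple of `h` up to high order; the cofactor has value one. -/
theorem mult_eq_one_of_notMem_sq (hκ : φ.IsConductorExponent κ) {i j : Fin r} (hij : j ≠ i)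
    {h : TwoVar} {n : ℕ} (hn : κ i ≤ n) (hi : φ.val i h = n)
    (hj : (φ.branch j).pullback h = 0) (h2 : h ∉ maxIdeal ^ 2) :
    φ.mult i = 1 ∧ φ.mult j = 1 := by
  have h0 : evalZero h = 0 := MapGerm.evalZero_eq_zero_of_ord_ne_zero (φ := φ.branch j)
    (by simp [hj])
  obtain ⟨Z, H⟩ := exists_isCoordPair h0 h2
  constructor
  · obtain ⟨h', hi', hj'⟩ := hκ.exists_val_eq_top i (hn.trans (Nat.le_succ n))
    obtain ⟨u, b, rfl⟩ := (φ.primitive j).exists_eq_of_pullback_eq_zero H hj (hj' j hij) (n + 2)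
    have hlarge : ((n + 2 : ℕ) : ℕ∞) ≤ ord ((φ.branch i).pullback (Z ^ (n + 2) * u)) := by
      rw [map_mul, map_pow]
      refine le_ord_mul_right _ ?_
      rw [ord_pow]
      exact le_mul_of_one_le_right' (one_le_ord.2 (by simpa using H.left))
    have hlt : ord ((φ.branch i).pullback (h * b)) <
        ord ((φ.branch i).pullback (Z ^ (n + 2) * u)) := by
      by_contra! hle
      have := le_ord_add hlarge (hlarge.trans hle)
      rw [← map_add] at this
      change _ ≤ φ.val i _ at this
      rw [hi'] at this
      have : n + 2 ≤ n + 1 := by exact_mod_cast this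
      omega
    have hb : ord ((φ.branch i).pullback (h * b)) = (n + 1 : ℕ) := by
      rw [← ord_add_eq_right hlt, ← map_add]
      exact hi'
    have hi : ord ((φ.branch i).pullback h) = n := hi
    rw [map_mul, ord_mul, hi, Nat.cast_add] at hb
    have hb1 : ord ((φ.branch i).pullback b) = (1 : ℕ) :=
      ENat.add_right_injective_of_ne_top (ENat.natCast_ne_top n) hb
    have hle := (φ.primitive i).mult_le_ord_pullback
      (MapGerm.evalZero_eq_zero_of_ord_ne_zero (by rw [hb1]; simp))
    rw [hb1] at hle
    have hle : φ.mult i ≤ 1 := by exact_mod_cast hle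
    have := (φ.primitive i).mult_ne_zero
    change φ.mult i ≠ 0 at this
    omega
  · obtain ⟨m, hm⟩ := ENat.ne_top_iff_exists.1
      (ord_eq_top.not.2 ((φ.primitive j).pullback_left_ne_zero H hj))
    obtain ⟨f, hf, -⟩ := hκ.exists_val_eq_top j (le_refl (κ j))
    obtain ⟨f', hf', -⟩ := hκ.exists_val_eq_top j (Nat.le_succ (κ j))
    have hd := MapGerm.dvd_of_ord_eq H hj hm.symm hf
    have hd' := MapGerm.dvd_of_ord_eq H hj hm.symm hf'
    have hm1 : m = 1 := Nat.dvd_one.1 ((Nat.dvd_add_right hd).1 hd')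
    have hle := (φ.primitive j).mult_le_ord_pullback H.left
    rw [← hm, hm1] at hle
    have hle : φ.mult j ≤ 1 := by exact_mod_cast hle
    have := (φ.primitive j).mult_ne_zero
    change φ.mult j ≠ 0 at this
    omega

theorem isConductorOne_of_mult_ne_one (hκ : φ.IsConductorExponent κ) {i j : Fin r} (hij : j ≠ i)
    (hmult : ¬ (φ.mult i = 1 ∧ φ.mult j = 1)) :
    IsConductorOne (φ.determinacyValues i) (κ i) := by
  refine hκ.isConductorOne_self i fun n hn => ?_
  obtain ⟨h, hi, htop⟩ := hκ.exists_val_eq_top i hn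
  refine ⟨h, ?_, fun k => ?_, hi⟩
  · by_contra h2
    exact hmult (hκ.mult_eq_one_of_notMem_sq hij hn hi (htop j hij) h2)
  · by_cases hk : k = i
    · subst hk
      rw [hi]
      exact_mod_cast hn
    · rw [val, htop k hk]
      simp

/-- For two smooth branches with the common tangent `Y = 0` the conductor is symmetric and at least
`2`, so the powers `X ^ n` with `n ≥ κᵢ` are germs of order at least two lying over it. -/
theorem isConductorOne_of_tangent (hκ : φ.IsConductorExponent κ) {i j : Fin r} (hij : j ≠ i)
    (honly : ∀ k, k = i ∨ k = j) (hmult : ∀ k, φ.mult k = 1)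
    (hX : ∀ k, ord ((φ.branch k).pullback coordX) = φ.mult k)
    (hY : ∀ k, (φ.mult k : ℕ∞) < ord ((φ.branch k).pullback coordY)) :
    IsConductorOne (φ.determinacyValues i) (κ i) := by
  have hpow : ∀ k (n : ℕ), φ.val k (coordX ^ n) = n := by
    intro k n
    rw [val, map_pow, ord_pow, hX, hmult]
    simp
  have hle : ∀ k l, κ k ≤ κ l := by
    have key : ∀ k l, k ≠ l → (∀ k', k' ≠ k → k' = l) → κ k ≤ κ l := by
      intro k l _ hkl'
      by_contra! hlt
      refine hκ.minimal k (coordX ^ (κ k - 1)) ?_ fun k' hk' => ?_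
      · rw [hpow]
        exact_mod_cast (by omega : κ k - 1 + 1 = κ k)
      · rw [hpow, hkl' k' hk']
        exact_mod_cast (by omega : κ l ≤ κ k - 1)
    intro k l
    by_cases hkl : k = l
    · rw [hkl]
    · refine key k l hkl fun k' hk' => ?_
      rcases honly k with rfl | rfl <;> rcases honly l with rfl | rfl <;>
        rcases honly k' with rfl | rfl <;> simp_all
  have h2 : 2 ≤ κ i := by
    by_contra! hlt
    obtain ⟨h, hi, htop⟩ := hκ.exists_val_eq_top i (n := 1) (by omega)
    have hi : ord ((φ.branch i).pullback h) = 1 := hi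
    have hj := htop j hij
    obtain ⟨a, b, g, hg, rfl⟩ := exists_linear_part
      (MapGerm.evalZero_eq_zero_of_ord_ne_zero (by rw [hi]; simp))
    by_cases ha : a = 0
    · have := MapGerm.lt_ord_pullback_of_linear_part (φ.primitive i) (hY i) b hg
      rw [ha, map_zero, zero_mul, zero_add] at hi
      have h1 : (φ.branch i).mult = 1 := hmult i
      rw [hi, h1] at this
      exact absurd this (by decide)
    · have := MapGerm.ord_pullback_of_linear_part (φ.primitive j) (hX j) (hY j) ha (b := b) hg
      rw [hj, ord_zero] at this
      exact ENat.top_ne_natCast _ this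
  refine hκ.isConductorOne_self i fun n hn => ⟨coordX ^ n, pow_mem_maxIdeal_sq rfl (by omega),
    fun k => ?_, hpow i n⟩
  rw [hpow]
  exact_mod_cast (hle k i).trans hn

/-- If each branch `k` has a germ `Z k` of value one that has value at least two on the others, then
all `κᵢ` equal one, whereas germs of order at least two have value at least two. -/
theorem isConductorOne_of_node (hκ : φ.IsConductorExponent κ) {i j : Fin r} (hij : j ≠ i)
    {Z : Fin r → TwoVar} (hZ0 : ∀ k, evalZero (Z k) = 0) (hZ : ∀ k, φ.val k (Z k) = 1)
    (hZ' : ∀ k l, l ≠ k → 2 ≤ φ.val l (Z k)) (hmult : φ.mult i = 1) :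
    IsConductorOne (φ.determinacyValues i) (κ i + 1) := by
  have hpow : ∀ k (n : ℕ), φ.val k (Z k ^ n) = n := by
    intro k n
    have := hZ k
    rw [val] at this
    rw [val, map_pow, ord_pow, this, mul_one]
  have hpow' : ∀ k l n, l ≠ k → ((2 * n : ℕ) : ℕ∞) ≤ φ.val l (Z k ^ n) := by
    intro k l n hkl
    have := hZ' k l hkl
    rw [val] at this
    rw [val, map_pow, ord_pow, Nat.cast_mul, mul_comm]
    gcongr
    exact this
  have hle1 : ∀ k, κ k ≤ 1 := by
    obtain ⟨k, -, hk⟩ := Finset.exists_max_image Finset.univ κ ⟨i, Finset.mem_univ i⟩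
    suffices κ k ≤ 1 from fun l => (hk l (Finset.mem_univ l)).trans this
    by_contra! hlt
    refine hκ.minimal k (Z k ^ (κ k - 1)) ?_ fun l hl => ?_
    · rw [hpow]
      exact_mod_cast (by omega : κ k - 1 + 1 = κ k)
    · refine le_trans ?_ (hpow' k l _ hl)
      have := hk l (Finset.mem_univ l)
      exact_mod_cast (by omega : κ l ≤ 2 * (κ k - 1))
  have hi1 : κ i = 1 := by
    refine le_antisymm (hle1 i) (Nat.pos_of_ne_zero fun h0 => ?_)
    obtain ⟨h, hi, htop⟩ := hκ.exists_val_eq_top i (n := 0) (by omega)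
    have h1 : evalZero h = 0 := MapGerm.evalZero_eq_zero_of_ord_ne_zero (φ := φ.branch j)
      (by simp [htop j hij])
    have hi : ord ((φ.branch i).pullback h) = 0 := hi
    rw [ord_eq_zero, MapGerm.evalZero_pullback] at hi
    exact hi h1
  rw [hi1]
  refine hκ.isConductorOne i (fun n hn => ⟨Z i ^ n, pow_mem_maxIdeal_sq (hZ0 i) hn, fun k => ?_,
    hpow i n⟩) fun n hn h hh _ hv => ?_
  · have := hle1 k
    by_cases hk : k = i
    · subst hk
      rw [hpow]
      exact_mod_cast (by omega : κ k ≤ n)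
    · refine le_trans ?_ (hpow' i k n hk)
      exact_mod_cast (by omega : κ k ≤ 2 * n)
  · have h1 := (φ.primitive i).two_mul_mult_le_ord_pullback hh
    have h2 : (φ.branch i).mult = 1 := hmult
    have hv : ord ((φ.branch i).pullback h) = n := hv
    rw [h2, hv] at h1
    have : 2 * 1 ≤ n := by exact_mod_cast h1
    omega

end IsConductorExponent

end Multigerm

/-! ### One branch, and the conclusion -/

namespace MapGerm

variable {φ : MapGerm}

/-- For a singular branch of multiplicity at least three, all values from the conductor `κ` on are
values of germs of order at least two. Otherwise some germ `h` of order one has such a value `v`;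
if `v` is a multiple of `n`, a power of `X` serves instead, and if not, then modulo germs of value
at least `2 v` all values lie in `n ℕ ∪ (v + n ℕ)`, which omits `v + 1` or `v + 2`. -/
theorem IsPrimitive.exists_mem_sq_ord_eq (hφ : φ.IsPrimitive)
    (hX : ord (φ.pullback coordX) = φ.mult) (hY : (φ.mult : ℕ∞) < ord (φ.pullback coordY))
    (hn : 3 ≤ φ.mult) {κ : ℕ} (hκ : ∀ v : ℕ, κ ≤ v → ∃ h, ord (φ.pullback h) = v) {v : ℕ}
    (hv : κ ≤ v) : ∃ h ∈ maxIdeal ^ 2, ord (φ.pullback h) = v := by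
  obtain ⟨h, hh⟩ := hκ v hv
  by_cases h2 : h ∈ maxIdeal ^ 2
  · exact ⟨h, h2, hh⟩
  have hv0 : v ≠ 0 := by
    rintro rfl
    obtain ⟨f, hf⟩ := hκ 1 (by omega)
    have := hφ.mult_le_ord_pullback (f := f) (evalZero_eq_zero_of_ord_ne_zero (by rw [hf]; simp))
    rw [hf] at this
    have : φ.mult ≤ 1 := by exact_mod_cast this
    omega
  have h0 : evalZero h = 0 := evalZero_eq_zero_of_ord_ne_zero (φ := φ)
    (by rw [hh]; exact_mod_cast hv0)
  obtain ⟨a, b, g, hg, rfl⟩ := exists_linear_part h0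
  by_cases ha : a = 0
  swap
  · -- the value `v` is the multiplicity `n`; the values `n + 1` and `n + 2` are impossible
    exfalso
    have hvn : v = φ.mult := by
      rw [ord_pullback_of_linear_part hφ hX hY ha hg] at hh
      exact_mod_cast hh.symm
    have key : ∀ w : ℕ, φ.mult < w → w < 2 * φ.mult → ∃ b' : ℂ, b' ≠ 0 ∧ ∃ g' ∈ maxIdeal ^ 2,
        ord (φ.pullback (constGerm _ b' * coordY + g')) = w := by
      intro w hw hw2
      obtain ⟨f, hf⟩ := hκ w (by omega)
      obtain ⟨a', b', g', hg', rfl⟩ := exists_linear_part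
        (evalZero_eq_zero_of_ord_ne_zero (φ := φ) (by
          rw [hf]; exact_mod_cast (by omega : w ≠ 0)))
      by_cases ha' : a' = 0
      · rw [ha', _root_.map_zero, zero_mul, zero_add] at hf
        refine ⟨b', ?_, g', hg', hf⟩
        rintro rfl
        rw [_root_.map_zero, zero_mul, zero_add] at hf
        have := hφ.two_mul_mult_le_ord_pullback hg'
        rw [hf] at this
        have : 2 * φ.mult ≤ w := by exact_mod_cast this
        omega
      · rw [ord_pullback_of_linear_part hφ hX hY ha' hg'] at hf
        have : φ.mult = w := by exact_mod_cast hf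
        omega
    obtain ⟨b₁, hb₁, g₁, hg₁, h₁⟩ := key (φ.mult + 1) (by omega) (by omega)
    obtain ⟨b₂, hb₂, g₂, hg₂, h₂⟩ := key (φ.mult + 2) (by omega) (by omega)
    have hsum : constGerm _ b₂ * (constGerm _ b₁ * coordY + g₁) +
        -(constGerm _ b₁ * (constGerm _ b₂ * coordY + g₂)) ∈ maxIdeal ^ 2 := by
      have : constGerm _ b₂ * (constGerm _ b₁ * coordY + g₁) +
          -(constGerm _ b₁ * (constGerm _ b₂ * coordY + g₂)) =
          constGerm _ b₂ * g₁ - constGerm _ b₁ * g₂ := by ring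
      rw [this]
      exact Ideal.sub_mem _ (Ideal.mul_mem_left _ _ hg₁) (Ideal.mul_mem_left _ _ hg₂)
    have hle := hφ.two_mul_mult_le_ord_pullback hsum
    have hu : ∀ {e : ℂ}, e ≠ 0 → ord (φ.pullback (constGerm _ e)) = 0 := fun he =>
      ord_pullback_of_isUnit (isUnit_of_evalZero_ne_zero (by simpa using he))
    have hlt : ord (φ.pullback (constGerm _ b₂ * (constGerm _ b₁ * coordY + g₁))) <
        ord (φ.pullback (-(constGerm _ b₁ * (constGerm _ b₂ * coordY + g₂)))) := by
      rw [map_neg, ord_neg, map_mul, map_mul, ord_mul, ord_mul, hu hb₁, hu hb₂, h₁, h₂]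
      exact_mod_cast (by omega : 0 + (φ.mult + 1) < 0 + (φ.mult + 2))
    rw [map_add, ord_add_eq_left hlt, map_mul, ord_mul, hu hb₂, h₁, zero_add] at hle
    have : 2 * φ.mult ≤ φ.mult + 1 := by exact_mod_cast hle
    omega
  have hb : b ≠ 0 := by
    rintro rfl
    exact h2 (by simpa [ha] using hg)
  have H := isCoordPair_of_linear_part (a := a) hb hg
  have hvn : φ.mult < v := by
    have := lt_ord_pullback_of_linear_part hφ hY b hg
    rw [ha, _root_.map_zero, zero_mul, zero_add] at hh
    rw [hh] at this
    exact_mod_cast this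
  set h := constGerm _ a * coordX + constGerm _ b * coordY + g
  set n := φ.mult
  by_cases hdvd : n ∣ v
  · obtain ⟨k, rfl⟩ := hdvd
    have hk : 2 ≤ k := by
      by_contra! hk
      interval_cases k <;> omega
    refine ⟨coordX ^ k, pow_mem_maxIdeal_sq rfl hk, ?_⟩
    rw [map_pow, ord_pow, hX, Nat.cast_mul, mul_comm]
  exfalso
  -- since `n ≥ 3`, the difference `u - v` is not a multiple of `n` either
  obtain ⟨u, hu1, hu2, hu3⟩ : ∃ u, v + 1 ≤ u ∧ u ≤ v + 2 ∧ ¬ n ∣ u := by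
    by_cases h1 : n ∣ v + 1
    · refine ⟨v + 2, by omega, le_rfl, fun h2 => ?_⟩
      have := Nat.le_of_dvd one_pos ((Nat.dvd_add_right h1).1 h2)
      omega
    · exact ⟨v + 1, le_rfl, by omega, h1⟩
  obtain ⟨f, hf⟩ := hκ u (by omega)
  -- `f = X ^ k α + h X ^ l γ + h² δ`, where `h² δ` has value at least `2 v > u`
  obtain ⟨k, hk, α, β, hfk, hα⟩ := H.exists_eq_pow_mul_add (u + 1) f
  obtain ⟨l, hl, γ, δ, hβ, hγ⟩ := H.exists_eq_pow_mul_add (u + 1) β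
  have hpow : ∀ {j : ℕ} {w : TwoVar}, j ≤ u + 1 → (j < u + 1 → IsUnit w) →
      ord (φ.pullback (coordX ^ j * w)) = (n * j : ℕ) ∨
        ((u + 1 : ℕ) : ℕ∞) ≤ ord (φ.pullback (coordX ^ j * w)) := by
    intro j w hj hw
    rcases hj.lt_or_eq with hlt | rfl
    · left
      rw [map_mul, ord_mul, ord_pullback_of_isUnit (hw hlt), add_zero, map_pow, ord_pow, hX,
        Nat.cast_mul, mul_comm]
    · right
      rw [map_mul]
      refine le_ord_mul_right _ ?_
      rw [map_pow, ord_pow, hX]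
      exact_mod_cast Nat.le_mul_of_pos_right (u + 1) (by omega)
  have h1 := hpow hk hα
  have h2' : ord (φ.pullback (h * (coordX ^ l * γ))) = (v + n * l : ℕ) ∨
      ((u + 1 : ℕ) : ℕ∞) ≤ ord (φ.pullback (h * (coordX ^ l * γ))) := by
    rw [map_mul, ord_mul, hh]
    rcases hpow hl hγ with h' | h'
    · left
      rw [h', Nat.cast_add]
    · right
      exact h'.trans le_add_self
  have h3 : ((u + 1 : ℕ) : ℕ∞) ≤ ord (φ.pullback (h ^ 2 * δ)) := by
    rw [map_mul]
    refine le_ord_mul_right _ ?_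
    rw [map_pow, ord_pow, hh]
    exact_mod_cast (by omega : u + 1 ≤ 2 * v)
  have hfsum : φ.pullback f = φ.pullback (coordX ^ k * α) +
      φ.pullback (h * (coordX ^ l * γ)) + φ.pullback (h ^ 2 * δ) := by
    rw [← map_add, ← map_add, hfk, hβ]
    congr 1
    ring
  -- `u` is neither in `n ℕ` nor in `v + n ℕ`, and these two sets are disjoint
  have hu4 : u ≠ n * k := fun h => hu3 ⟨k, h⟩
  have hu5 : u ≠ v + n * l := by
    intro h
    have h6 : n ∣ u - v := ⟨l, by omega⟩
    have := Nat.le_of_dvd (by omega) h6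
    omega
  have hne : n * k ≠ v + n * l := by
    intro h
    exact hdvd ((Nat.dvd_add_left (dvd_mul_right n l)).1 (h ▸ dvd_mul_right n k))
  have hordf : ord (φ.pullback (coordX ^ k * α) + φ.pullback (h * (coordX ^ l * γ)) +
      φ.pullback (h ^ 2 * δ)) = u := by rw [← hfsum, hf]
  have hsmall : ∀ {p q : OneVar} {e : ℕ}, ord p = e → e ≠ u → ((e + 1 : ℕ) : ℕ∞) ≤ ord q →
      ord (p + q) ≠ u := by
    intro p q e hp he hq hpq
    rw [ord_add_eq_left, hp] at hpq
    · exact he (by exact_mod_cast hpq)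
    · rw [hp]
      exact lt_of_lt_of_le (by exact_mod_cast Nat.lt_succ_self e) hq
  have hbig : ∀ {p : OneVar}, ((u + 1 : ℕ) : ℕ∞) ≤ ord p → ord p ≠ u := by
    intro p hp hpu
    rw [hpu] at hp
    have : u + 1 ≤ u := by exact_mod_cast hp
    omega
  have hmono : ∀ {e e' : ℕ} {p : OneVar}, (e' : ℕ∞) ≤ ord p → e ≤ e' → (e : ℕ∞) ≤ ord p :=
    fun h h' => le_trans (by exact_mod_cast h') h
  set p := φ.pullback (coordX ^ k * α)
  set q := φ.pullback (h * (coordX ^ l * γ))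
  set t := φ.pullback (h ^ 2 * δ)
  by_cases hp : ((u + 1 : ℕ) : ℕ∞) ≤ ord p
  · by_cases hq : ((u + 1 : ℕ) : ℕ∞) ≤ ord q
    · exact hbig (le_ord_add (le_ord_add hp hq) h3) hordf
    · have hq' := h2'.resolve_right hq
      rw [hq', Nat.cast_le, not_le] at hq
      rw [add_comm p q, add_assoc] at hordf
      exact hsmall hq' hu5.symm (hmono (le_ord_add hp h3) (by omega)) hordf
  · have hp' := h1.resolve_right hp
    rw [hp', Nat.cast_le, not_le] at hp
    by_cases hlt : ((n * k + 1 : ℕ) : ℕ∞) ≤ ord q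
    · rw [add_assoc] at hordf
      exact hsmall hp' hu4.symm (le_ord_add hlt (hmono h3 (by omega))) hordf
    · have hq' : ord q = (v + n * l : ℕ) := by
        refine h2'.resolve_right fun h' => hlt (hmono h' (by omega))
      rw [hq', Nat.cast_le, not_le] at hlt
      rw [add_comm p q, add_assoc] at hordf
      refine hsmall hq' hu5.symm (le_ord_add ?_ (hmono h3 (by omega))) hordf
      rw [hp']
      exact_mod_cast (by omega : v + n * l + 1 ≤ n * k)

/-- On a branch of multiplicity two with conductor `κ`, the odd value `κ + 1` is not a value of a
germ of order at least two. Modifying `Y` by a series in `X`, its value can be raised to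
`κ + 1`, the smallest odd value; in the coordinates so obtained the claim is visible. -/
theorem ord_ne_of_mem_sq (hX : ord (φ.pullback coordX) = 2)
    (hY : 2 < ord (φ.pullback coordY)) {κ : ℕ} (hκ2 : 2 ≤ κ)
    (hκ : ∀ h, ord (φ.pullback h) + 1 ≠ κ) {h : TwoVar} (hh : h ∈ maxIdeal ^ 2) :
    ord (φ.pullback h) ≠ (κ + 1 : ℕ) := by
  intro hord
  have hXpow : ∀ k : ℕ, ord (φ.pullback (coordX ^ k)) = (2 * k : ℕ) := by
    intro k
    rw [map_pow, ord_pow, hX, Nat.cast_mul, mul_comm]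
    rfl
  -- otherwise a power of `X` has value `κ - 1`
  have hpar : κ % 2 = 0 := by
    by_contra hodd
    refine hκ (coordX ^ ((κ - 1) / 2)) ?_
    rw [hXpow]
    exact_mod_cast (by omega : 2 * ((κ - 1) / 2) + 1 = κ)
  have hraise : ∀ N : ℕ, N ≤ κ + 1 → ∃ W, IsCoordPair coordX W ∧ (N : ℕ∞) ≤ ord (φ.pullback W) := by
    intro N
    induction N with
    | zero => exact fun _ => ⟨coordY, isCoordPair_coord, by simp⟩
    | succ N ih =>
      intro hN
      by_cases hN2 : N + 1 ≤ 2
      · exact ⟨coordY, isCoordPair_coord, le_trans (by exact_mod_cast hN2) hY.le⟩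
      obtain ⟨W, H, hW⟩ := ih (by omega)
      by_cases hlt : (N : ℕ∞) < ord (φ.pullback W)
      · refine ⟨W, H, ?_⟩
        rw [Nat.cast_add, Nat.cast_one]
        exact Order.add_one_le_of_lt hlt
      have hWN : ord (φ.pullback W) = N := le_antisymm (not_lt.1 hlt) hW
      rcases Nat.even_or_odd' N with ⟨k, rfl | rfl⟩
      · obtain ⟨c, hc⟩ := exists_lt_ord_sub (hXpow k) hW
        refine ⟨coordX * (-(constGerm _ c) * coordX ^ (k - 1)) + W * 1, H.replace_right isUnit_one,
          ?_⟩
        have hk : coordX ^ k = coordX * coordX ^ (k - 1) := by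
          rw [← pow_succ', Nat.sub_add_cancel (by omega)]
        have : φ.pullback (coordX * (-(constGerm _ c) * coordX ^ (k - 1)) + W * 1) =
            φ.pullback W - constGerm ℂ c * φ.pullback (coordX ^ k) := by
          rw [hk, ← pullback_constGerm φ c, ← map_mul, ← map_sub]
          congr 1
          ring
        rwa [this]
      · -- an odd value below `κ + 1` would give the value `κ - 1`, after multiplication by a power
        -- of `X`
        exfalso
        refine hκ (coordX ^ ((κ - 1 - (2 * k + 1)) / 2) * W) ?_
        rw [map_mul, ord_mul, hXpow, hWN]
        exact_mod_cast (by omega : 2 * ((κ - 1 - (2 * k + 1)) / 2) + (2 * k + 1) + 1 = κ)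
  obtain ⟨W, H, hW⟩ := hraise (κ + 1) le_rfl
  obtain ⟨A, B, hA, hB, hAB⟩ := H.exists_eq_of_mem_sq hh
  obtain ⟨k, hk, u, b, hAu, hu⟩ := H.exists_eq_pow_mul_add (κ + 1) A
  have hsplit : φ.pullback h = φ.pullback (coordX ^ (k + 1) * u) +
      φ.pullback (W * (B + coordX * b)) := by
    rw [← map_add, hAB, hAu]
    congr 1
    ring
  have hsecond : ((κ + 2 : ℕ) : ℕ∞) ≤ ord (φ.pullback (W * (B + coordX * b))) := by
    rw [map_mul, ord_mul]
    have : 1 ≤ ord (φ.pullback (B + coordX * b)) := one_le_ord.2 (by simp [hB])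
    have := add_le_add hW this
    exact_mod_cast this
  have hbig : ∀ {p : OneVar}, ((κ + 2 : ℕ) : ℕ∞) ≤ ord p → ord p ≠ (κ + 1 : ℕ) := by
    intro p hp hpu
    rw [hpu] at hp
    have : κ + 2 ≤ κ + 1 := by exact_mod_cast hp
    omega
  by_cases hfirst : ((κ + 2 : ℕ) : ℕ∞) ≤ ord (φ.pullback (coordX ^ (k + 1) * u))
  · rw [hsplit] at hord
    exact hbig (le_ord_add hfirst hsecond) hord
  · rcases hk.lt_or_eq with hlt | rfl
    · have hval : ord (φ.pullback (coordX ^ (k + 1) * u)) = (2 * (k + 1) : ℕ) := by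
        rw [map_mul, ord_mul, hXpow, ord_pullback_of_isUnit (hu hlt), add_zero]
      have hlt' := not_le.1 hfirst
      rw [hsplit, ord_add_eq_left (hlt'.trans_le hsecond), hval] at hord
      have : 2 * (k + 1) = κ + 1 := by exact_mod_cast hord
      omega
    · refine hfirst ?_
      rw [map_mul]
      refine le_ord_mul_right _ ?_
      rw [hXpow]
      exact_mod_cast (by omega : κ + 2 ≤ 2 * (κ + 1 + 1))

end MapGerm

namespace Multigerm

variable {r : ℕ} {φ : Multigerm r} {κ : Fin r → ℕ}

namespace IsConductorExponent

/-- The case of a single branch. -/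
theorem isConductorOne_irreducible (hκ : φ.IsConductorExponent κ) {i : Fin r}
    (honly : ∀ j, j = i)
    (hX : ord ((φ.branch i).pullback coordX) = φ.mult i)
    (hY : (φ.mult i : ℕ∞) < ord ((φ.branch i).pullback coordY)) :
    IsConductorOne (φ.determinacyValues i) (if φ.mult i ≤ 2 then κ i + 2 else κ i) := by
  have hprim := φ.primitive i
  have hval : ∀ v : ℕ, κ i ≤ v → ∃ h, ord ((φ.branch i).pullback h) = v := fun v hv =>
    (hκ.exists_val_eq_top i hv).imp fun h hh => hh.1
  have hmin : ∀ h, ord ((φ.branch i).pullback h) + 1 ≠ κ i := fun h hh =>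
    hκ.minimal i h hh fun j hj => absurd (honly j) hj
  have hall : ∀ {h : TwoVar} {v : ℕ}, ord ((φ.branch i).pullback h) = v → κ i ≤ v →
      ∀ j, (κ j : ℕ∞) ≤ φ.val j h := by
    intro h v hv hle j
    rw [honly j, val, hv]
    exact_mod_cast hle
  have hm0 : φ.mult i ≠ 0 := hprim.mult_ne_zero
  split_ifs with hm
  · obtain hm1 | hm2 : φ.mult i = 1 ∨ φ.mult i = 2 := by omega
    · have hpow : ∀ n : ℕ, ord ((φ.branch i).pullback (coordX ^ n)) = n := by
        intro n
        rw [map_pow, ord_pow, hX, hm1, Nat.cast_one, mul_one]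
      have hκ0 : κ i = 0 := by
        by_contra h0
        refine hmin (coordX ^ (κ i - 1)) ?_
        rw [hpow]
        exact_mod_cast (by omega : κ i - 1 + 1 = κ i)
      refine hκ.isConductorOne i (fun n hn => ⟨coordX ^ n, pow_mem_maxIdeal_sq rfl (by omega),
        hall (hpow n) (by omega), hpow n⟩) fun n hn h hh _ hv => ?_
      have h1 := hprim.two_mul_mult_le_ord_pullback hh
      have h2 : (φ.branch i).mult = 1 := hm1
      have hv : ord ((φ.branch i).pullback h) = n := hv
      rw [h2, hv] at h1
      have : 2 * 1 ≤ n := by exact_mod_cast h1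
      omega
    · have hκ2 : 2 ≤ κ i := by
        by_contra! hlt
        obtain ⟨f, hf⟩ := hval 1 (by omega)
        have h1 := hprim.mult_le_ord_pullback (f := f)
          (MapGerm.evalZero_eq_zero_of_ord_ne_zero (φ := φ.branch i) (by rw [hf]; simp))
        have h2 : (φ.branch i).mult = 2 := hm2
        rw [h2, hf] at h1
        have : 2 ≤ 1 := by exact_mod_cast h1
        omega
      refine hκ.isConductorOne i (fun n hn => ?_) fun n hn h hh _ hv => ?_
      · obtain ⟨f, hf⟩ := hval (n - 2) (by omega)
        have hXf : ord ((φ.branch i).pullback (coordX * f)) = n := by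
          rw [map_mul, ord_mul, hX, hf, hm2]
          exact_mod_cast (by omega : 2 + (n - 2) = n)
        refine ⟨coordX * f, mul_mem_maxIdeal_sq rfl ?_, hall hXf (by omega), hXf⟩
        refine MapGerm.evalZero_eq_zero_of_ord_ne_zero (φ := φ.branch i) ?_
        rw [hf]
        exact_mod_cast (by omega : n - 2 ≠ 0)
      · rw [hm2] at hX hY
        obtain rfl : n = κ i + 1 := by omega
        exact MapGerm.ord_ne_of_mem_sq hX hY hκ2 hmin hh hv
  · refine hκ.isConductorOne_self i fun n hn => ?_
    obtain ⟨h, hh, hv⟩ := hprim.exists_mem_sq_ord_eq hX hY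
      (show 3 ≤ φ.mult i by omega) hval hn
    exact ⟨h, hh, hall hv hn, hv⟩

theorem isConductorOne_of_isBlockForm (hκ : φ.IsConductorExponent κ) {s : ℕ}
    (hφ : φ.IsBlockForm s) (i : Fin r) :
    IsConductorOne (φ.determinacyValues i)
      (if r = 1 ∧ φ.mult i ≤ 2 then κ i + 2
        else if r = 2 ∧ s = 2 ∧ ∀ j, φ.mult j = 1 then κ i + 1
        else κ i) := by
  obtain ⟨b, θ, -, hsurj, hslope, -, hθ0, hθ1, -, -, -⟩ := hφ
  have hs : s ≤ r := by simpa using Fintype.card_le_of_surjective b hsurj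
  have hzero : ∀ j, (b j).val = 0 → ord ((φ.branch j).pullback coordX) = φ.mult j ∧
      (φ.mult j : ℕ∞) < ord ((φ.branch j).pullback coordY) := fun j hj =>
    (φ.primitive j).ord_of_slope_eq_zero ((hslope j).trans (hθ0 _ hj))
  have hinfty : ∀ j, (b j).val = 1 → ord ((φ.branch j).pullback coordY) = φ.mult j ∧
      (φ.mult j : ℕ∞) < ord ((φ.branch j).pullback coordX) := fun j hj =>
    (φ.primitive j).ord_of_slope_eq_infty ((hslope j).trans (hθ1 _ hj))
  have hbi := (b i).isLt
  have hi := i.isLt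
  by_cases hr1 : r = 1
  · have h0 := hzero i (by omega)
    simp only [hr1, true_and, OfNat.one_ne_ofNat, false_and, if_false]
    exact hκ.isConductorOne_irreducible (fun j => by ext; omega) h0.1 h0.2
  rw [if_neg fun h => hr1 h.1]
  by_cases hr3 : 3 ≤ r
  · rw [if_neg fun h => by omega]
    exact hκ.isConductorOne_of_three_le hr3 i
  obtain ⟨j, hij, honly⟩ : ∃ j, j ≠ i ∧ ∀ k, k = i ∨ k = j := by
    refine ⟨⟨1 - i, by omega⟩, fun h => ?_, fun k => ?_⟩
    · have : 1 - (i : ℕ) = i := congrArg Fin.val h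
      omega
    · have := k.isLt
      rw [Fin.ext_iff, Fin.ext_iff]
      change (k : ℕ) = i ∨ (k : ℕ) = 1 - i
      omega
  by_cases hmult : ∀ k, φ.mult k = 1
  swap
  · rw [if_neg fun h => hmult h.2.2]
    refine hκ.isConductorOne_of_mult_ne_one hij fun h => hmult fun k => ?_
    rcases honly k with rfl | rfl
    exacts [h.1, h.2]
  by_cases hs2 : s = 2
  · rw [if_pos ⟨by omega, hs2, hmult⟩]
    have hinj : Function.Injective b :=
      (Function.Surjective.bijective_of_nat_card_le hsurj (by simp; omega)).1
    have hb2 : ∀ k, (b k).val = 0 ∨ (b k).val = 1 := fun k => by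
      have := (b k).isLt
      omega
    -- each branch is transversal to exactly one of the coordinate axes
    have htwo : ∀ {x : ℕ∞}, (1 : ℕ) < x → 2 ≤ x := fun h => by
      have := Order.add_one_le_of_lt h
      exact_mod_cast this
    refine hκ.isConductorOne_of_node hij
      (Z := fun k => if (b k).val = 0 then coordX else coordY) (fun k => ?_) (fun k => ?_)
      (fun k l hkl => ?_) (hmult i)
    · split_ifs <;> rfl
    · split_ifs with hk
      · exact (hzero k hk).1.trans (by simp [hmult k])
      · exact (hinfty k ((hb2 k).resolve_left hk)).1.trans (by simp [hmult k])
    · have hne : (b l).val ≠ (b k).val := fun h => hkl (hinj (Fin.ext h))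
      split_ifs with hk
      · refine htwo ?_
        rw [← hmult l]
        exact (hinfty l ((hb2 l).resolve_left (by omega))).2
      · refine htwo ?_
        rw [← hmult l]
        have := hb2 k
        have := hb2 l
        exact (hzero l (by omega)).2
  · rw [if_neg fun h => hs2 h.2.1]
    have hb0 : ∀ k, (b k).val = 0 := fun k => by
      have := (b k).isLt
      omega
    exact hκ.isConductorOne_of_tangent hij honly hmult (fun k => (hzero k (hb0 k)).1)
      fun k => (hzero k (hb0 k)).2

end IsConductorExponent

end Multigerm

end

end PlaneCurve

theorem proposition4p4 (r s : ℕ) (φ : PlaneCurve.Multigerm r) (hφ : φ.IsBlockForm s) :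
    ∃ κ : Fin r → ℕ,
      (∀ c : Fin r → ℕ, PlaneCurve.IsConductor φ.valueSemiring c ↔ c = κ) ∧
      ∀ (i : Fin r) (d : ℕ), PlaneCurve.IsConductorOne (φ.determinacyValues i) d ↔
        d = if r = 1 ∧ φ.mult i ≤ 2 then κ i + 2
          else if r = 2 ∧ s = 2 ∧ ∀ j, φ.mult j = 1 then κ i + 1
          else κ i := by
  obtain ⟨N, hN⟩ := φ.exists_forall_le_ord_mem_localRing
  obtain ⟨κ, hκ⟩ := φ.exists_isConductorExponent hN
  exact ⟨κ, hκ.isConductor_iff, fun i => PlaneCurve.isConductorOne_iff_of_isConductorOne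
    (hκ.isConductorOne_of_isBlockForm hφ i)⟩
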